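/- Let $\mathbb{F}$ be a field of characteristic $0$. Graphs are finite and undirected; loops and multiple edges are allowed, and the graph without vertices is a graph. The graph algebra $\mathcal{G}$ is the $\mathbb{F}$-vector space with basis the isomorphism classes of graphs. It is a Hopf algebra with product $G\cdot H=G\uplus H$ (disjoint union), unit the graph without vertices, coproduct $\Delta(G)=\sum_{T\subseteq V(G)}G|_T\otimes G|_{V(G)\setminus T}$ (where $G|_T$ is the subgraph induced on $T$), and counit $\epsilon(G)=1$ if $G$ has no vertices and $\epsilon(G)=0$ otherwise. Let $S$ be its antipode. For a graph $G=(V,E)$ and $F\subseteq E$, let $G_{V,F}$ be the subgraph with vertex set $V$ and edge set $F$; let $\mathrm{rk}(F)$ be the maximal size of an acyclic subset of $F$; call $F$ a flat if $F$ contains every edge of $G$ whose endpoints are joined by a (possibly trivial) path in $F$; let $\mathrm{Flat}(G)$ be the set of flats of $G$; and let $G/F$ be the graph obtained by contracting all edges of $F$. Let $a(H)$ be the number of acyclic orientations of a graph $H$, that is, of orientations of all edges of $H$ without directed cycles (so $a(H)=0$ if $H$ has a loop). Theorem 3.1. Let $G=(V,E)$ be a graph with $n=|V|$. Then in $\mathcal{G}$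 $$S(G)=\sum_{F\in\mathrm{Flat}(G)}(-1)^{n-\mathrm{rk}(F)}\,a(G/F)\,G_{V,F}.$$ -/

import Mathlib

open scoped Graph TensorProduct

namespace Graph

/-- Isomorphism of multigraphs: bijections of the vertex sets and of the edge sets that preserve
and reflect incidence. -/
def IsIso {α β α' β' : Type*} (G : Graph α β) (H : Graph α' β') : Prop :=
  ∃ (f : V(G) ≃ V(H)) (g : E(G) ≃ E(H)),
    ∀ (e : E(G)) (x y : V(G)), G.IsLink e x y ↔ H.IsLink (g e) (f x) (f y)

theorem IsIso.refl {α β : Type*} (G : Graph α β) : G.IsIso G :=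
  ⟨Equiv.refl _, Equiv.refl _, fun _ _ _ => Iff.rfl⟩

theorem IsIso.symm {α β α' β' : Type*} {G : Graph α β} {H : Graph α' β'} :
    G.IsIso H → H.IsIso G := by
  rintro ⟨f, g, h⟩
  exact ⟨f.symm, g.symm, fun e x y => by simp [h]⟩

theorem IsIso.trans {α β α' β' α'' β'' : Type*} {G : Graph α β} {H : Graph α' β'}
    {K : Graph α'' β''} : G.IsIso H → H.IsIso K → G.IsIso K := by
  rintro ⟨f, g, h⟩ ⟨f', g', h'⟩
  exact ⟨f.trans f', g.trans g', fun e x y => by simp [h, h']⟩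

theorem IsIso.of_bijective {α β α' β' : Type*} {G : Graph α β} {H : Graph α' β'}
    (f : V(G) → V(H)) (g : E(G) → E(H)) (hf : f.Bijective) (hg : g.Bijective)
    (h : ∀ (e : E(G)) (x y : V(G)), G.IsLink e x y → H.IsLink (g e) (f x) (f y)) :
    G.IsIso H := by
  refine ⟨Equiv.ofBijective f hf, Equiv.ofBijective g hg, fun e x y => ⟨h e x y, fun h' => ?_⟩⟩
  obtain ⟨x', y', hl⟩ := G.exists_isLink_of_mem_edgeSet e.2
  have h2 := h e ⟨x', hl.left_mem⟩ ⟨y', hl.right_mem⟩ hl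
  obtain ⟨h3, h4⟩ | ⟨h3, h4⟩ := h2.eq_and_eq_or_eq_and_eq h'
  · have h3' := hf.1 (Subtype.ext h3)
    have h4' := hf.1 (Subtype.ext h4)
    subst h3' h4'
    exact hl
  · have h3' := hf.1 (Subtype.ext h3)
    have h4' := hf.1 (Subtype.ext h4)
    subst h3' h4'
    exact hl.symm

theorem IsIso.of_bijOn {α β α' β' : Type*} {G : Graph α β} {H : Graph α' β'}
    (f : α → α') (g : β → β') (hf : Set.BijOn f V(G) V(H)) (hg : Set.BijOn g E(G) E(H))
    (h : ∀ e x y, G.IsLink e x y → H.IsLink (g e) (f x) (f y)) : G.IsIso H :=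
  IsIso.of_bijective (hf.mapsTo.restrict) (hg.mapsTo.restrict)
    hf.bijective hg.bijective (fun _ _ _ hl => h _ _ _ hl)

/-- Disjoint union of multigraphs. -/
def disjSum {α β α' β' : Type*} (G : Graph α β) (H : Graph α' β') :
    Graph (α ⊕ α') (β ⊕ β') where
  vertexSet := Sum.inl '' V(G) ∪ Sum.inr '' V(H)
  edgeSet := Sum.inl '' E(G) ∪ Sum.inr '' E(H)
  IsLink e x y := (∃ e' x' y', e = .inl e' ∧ x = .inl x' ∧ y = .inl y' ∧ G.IsLink e' x' y') ∨
    (∃ e' x' y', e = .inr e' ∧ x = .inr x' ∧ y = .inr y' ∧ H.IsLink e' x' y')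
  isLink_symm e _ := ⟨by
    rintro x y (⟨e', x', y', rfl, rfl, rfl, h⟩ | ⟨e', x', y', rfl, rfl, rfl, h⟩)
    · exact .inl ⟨_, _, _, rfl, rfl, rfl, h.symm⟩
    · exact .inr ⟨_, _, _, rfl, rfl, rfl, h.symm⟩⟩
  eq_or_eq_of_isLink_of_isLink := by
    rintro e x y v w (⟨e', x', y', rfl, rfl, rfl, h⟩ | ⟨e', x', y', rfl, rfl, rfl, h⟩)
      (⟨e'', x'', y'', h1, rfl, rfl, h'⟩ | ⟨e'', x'', y'', h1, rfl, rfl, h'⟩) <;> cases h1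
    · simpa using h.left_eq_or_eq h'
    · simpa using h.left_eq_or_eq h'
  edge_mem_iff_exists_isLink e := by
    constructor
    · rintro (⟨e, he, rfl⟩ | ⟨e, he, rfl⟩)
      · obtain ⟨x, y, h⟩ := G.exists_isLink_of_mem_edgeSet he
        exact ⟨_, _, .inl ⟨_, _, _, rfl, rfl, rfl, h⟩⟩
      · obtain ⟨x, y, h⟩ := H.exists_isLink_of_mem_edgeSet he
        exact ⟨_, _, .inr ⟨_, _, _, rfl, rfl, rfl, h⟩⟩
    · rintro ⟨x, y, ⟨e', x', y', rfl, rfl, rfl, h⟩ | ⟨e', x', y', rfl, rfl, rfl, h⟩⟩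
      · exact .inl ⟨_, h.edge_mem, rfl⟩
      · exact .inr ⟨_, h.edge_mem, rfl⟩
  left_mem_of_isLink := by
    rintro e x y (⟨e', x', y', rfl, rfl, rfl, h⟩ | ⟨e', x', y', rfl, rfl, rfl, h⟩)
    · exact .inl ⟨_, h.left_mem, rfl⟩
    · exact .inr ⟨_, h.left_mem, rfl⟩

section FiniteInstances

instance {α β α' β' : Type*} (G : Graph α β) (H : Graph α' β') [Finite V(G)] [Finite V(H)] :
    Finite V(G.disjSum H) :=
  inferInstanceAs (Finite ↑(Sum.inl '' V(G) ∪ Sum.inr '' V(H)))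

instance {α β α' β' : Type*} (G : Graph α β) (H : Graph α' β') [Finite E(G)] [Finite E(H)] :
    Finite E(G.disjSum H) :=
  inferInstanceAs (Finite ↑(Sum.inl '' E(G) ∪ Sum.inr '' E(H)))

instance {α β : Type*} (G : Graph α β) (X : Set α) [Finite X] : Finite V(G.induce X) :=
  inferInstanceAs (Finite X)

instance {α β : Type*} (G : Graph α β) (X : Set α) [Finite E(G)] : Finite E(G.induce X) :=
  Set.Finite.subset (Set.toFinite E(G)) (by
    intro e he
    obtain ⟨x, y, h⟩ := exists_isLink_of_mem_edgeSet he
    exact h.1.edge_mem)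

instance {α β : Type*} (G : Graph α β) (A : Set β) [Finite V(G)] : Finite V(G.restrict A) :=
  inferInstanceAs (Finite V(G))

instance {α β : Type*} (G : Graph α β) (A : Set β) [Finite E(G)] : Finite E(G.restrict A) :=
  inferInstanceAs (Finite ↑(E(G) ∩ A))

instance {α β : Type*} : Finite V((⊥ : Graph α β)) :=
  Set.Finite.to_subtype (by simp)

instance {α β : Type*} : Finite E((⊥ : Graph α β)) :=
  Set.Finite.to_subtype (by simp)

end FiniteInstances


/-- The graph isomorphisms seen as pairs of relations (the graphs of the two bijections). -/
structure RelIso {α β α' β' : Type*} (G : Graph α β) (H : Graph α' β')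
    (R : α → α' → Prop) (Q : β → β' → Prop) : Prop where
  left : ∀ x ∈ V(G), ∃ y ∈ V(H), R x y
  right : ∀ y ∈ V(H), ∃ x ∈ V(G), R x y
  fn : ∀ x ∈ V(G), ∀ y ∈ V(H), ∀ y' ∈ V(H), R x y → R x y' → y = y'
  inj : ∀ x ∈ V(G), ∀ x' ∈ V(G), ∀ y ∈ V(H), R x y → R x' y → x = x'
  leftE : ∀ e ∈ E(G), ∃ d ∈ E(H), Q e d
  rightE : ∀ d ∈ E(H), ∃ e ∈ E(G), Q e d
  fnE : ∀ e ∈ E(G), ∀ d ∈ E(H), ∀ d' ∈ E(H), Q e d → Q e d' → d = d'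
  injE : ∀ e ∈ E(G), ∀ e' ∈ E(G), ∀ d ∈ E(H), Q e d → Q e' d → e = e'
  link : ∀ e x y, G.IsLink e x y → ∀ d ∈ E(H), ∀ x' ∈ V(H), ∀ y' ∈ V(H),
    Q e d → R x x' → R y y' → H.IsLink d x' y'

theorem RelIso.isIso {α β α' β' : Type*} {G : Graph α β} {H : Graph α' β'}
    {R : α → α' → Prop} {Q : β → β' → Prop} (h : RelIso G H R Q) : G.IsIso H := by
  choose f hf hfR using h.left
  choose g hg hgQ using h.leftE
  refine IsIso.of_bijective (fun x => ⟨f x x.2, hf x x.2⟩) (fun e => ⟨g e e.2, hg e e.2⟩)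
    ⟨?_, ?_⟩ ⟨?_, ?_⟩ ?_
  · rintro ⟨x, hx⟩ ⟨x', hx'⟩ he
    have he : f x hx = f x' hx' := congrArg Subtype.val he
    exact Subtype.ext (h.inj x hx x' hx' _ (hf x hx) (hfR x hx) (he ▸ hfR x' hx'))
  · rintro ⟨y, hy⟩
    obtain ⟨x, hx, hxy⟩ := h.right y hy
    exact ⟨⟨x, hx⟩, Subtype.ext (h.fn x hx _ (hf x hx) _ hy (hfR x hx) hxy)⟩
  · rintro ⟨x, hx⟩ ⟨x', hx'⟩ he
    have he : g x hx = g x' hx' := congrArg Subtype.val he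
    exact Subtype.ext (h.injE x hx x' hx' _ (hg x hx) (hgQ x hx) (he ▸ hgQ x' hx'))
  · rintro ⟨y, hy⟩
    obtain ⟨x, hx, hxy⟩ := h.rightE y hy
    exact ⟨⟨x, hx⟩, Subtype.ext (h.fnE x hx _ (hg x hx) _ hy (hgQ x hx) hxy)⟩
  · rintro ⟨e, he⟩ ⟨x, hx⟩ ⟨y, hy⟩ hl
    exact h.link e x y hl _ (hg e he) _ (hf x hx) _ (hf y hy) (hgQ e he) (hfR x hx) (hfR y hy)

theorem IsIso.exists_relIso {α β α' β' : Type*} {G : Graph α β} {H : Graph α' β'}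
    (h : G.IsIso H) : ∃ R Q, RelIso G H R Q := by
  obtain ⟨f, g, h⟩ := h
  refine ⟨fun x y => ∃ hx : x ∈ V(G), (f ⟨x, hx⟩ : α') = y,
    fun x y => ∃ hx : x ∈ E(G), (g ⟨x, hx⟩ : β') = y, ?_⟩
  constructor
  · exact fun x hx => ⟨_, (f ⟨x, hx⟩).2, hx, rfl⟩
  · exact fun y hy => ⟨f.symm ⟨y, hy⟩, (f.symm ⟨y, hy⟩).2, (f.symm ⟨y, hy⟩).2, by simp⟩
  · rintro x hx y hy y' hy' ⟨_, rfl⟩ ⟨_, rfl⟩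
    rfl
  · rintro x hx x' hx' y hy ⟨_, rfl⟩ ⟨_, h2⟩
    simpa using (f.injective (Subtype.ext h2)).symm
  · exact fun x hx => ⟨_, (g ⟨x, hx⟩).2, hx, rfl⟩
  · exact fun y hy => ⟨g.symm ⟨y, hy⟩, (g.symm ⟨y, hy⟩).2, (g.symm ⟨y, hy⟩).2, by simp⟩
  · rintro x hx y hy y' hy' ⟨_, rfl⟩ ⟨_, rfl⟩
    rfl
  · rintro x hx x' hx' y hy ⟨_, rfl⟩ ⟨_, h2⟩
    simpa using (g.injective (Subtype.ext h2)).symm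
  · rintro e x y hl d hd x' hx' y' hy' ⟨he, rfl⟩ ⟨hx, rfl⟩ ⟨hy, rfl⟩
    exact (h ⟨e, he⟩ ⟨x, hx⟩ ⟨y, hy⟩).1 hl

theorem IsIso.disjSum {α β α' β' α₂ β₂ α₂' β₂' : Type*} {G : Graph α β} {G' : Graph α' β'}
    {H : Graph α₂ β₂} {H' : Graph α₂' β₂'} (h₁ : G.IsIso G') (h₂ : H.IsIso H') :
    (G.disjSum H).IsIso (G'.disjSum H') := by
  obtain ⟨R, Q, h⟩ := h₁.exists_relIso
  obtain ⟨R', Q', h'⟩ := h₂.exists_relIso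
  have : RelIso (G.disjSum H) (G'.disjSum H') (Sum.LiftRel R R') (Sum.LiftRel Q Q') := by
    constructor
    · rintro _ (⟨x, hx, rfl⟩ | ⟨x, hx, rfl⟩)
      · obtain ⟨y, hy, hr⟩ := h.left x hx
        exact ⟨_, .inl ⟨y, hy, rfl⟩, .inl hr⟩
      · obtain ⟨y, hy, hr⟩ := h'.left x hx
        exact ⟨_, .inr ⟨y, hy, rfl⟩, .inr hr⟩
    · rintro _ (⟨x, hx, rfl⟩ | ⟨x, hx, rfl⟩)
      · obtain ⟨y, hy, hr⟩ := h.right x hx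
        exact ⟨_, .inl ⟨y, hy, rfl⟩, .inl hr⟩
      · obtain ⟨y, hy, hr⟩ := h'.right x hx
        exact ⟨_, .inr ⟨y, hy, rfl⟩, .inr hr⟩
    · rintro _ (⟨x, hx, rfl⟩ | ⟨x, hx, rfl⟩) _ (⟨y, hy, rfl⟩ | ⟨y, hy, rfl⟩) _
        (⟨z, hz, rfl⟩ | ⟨z, hz, rfl⟩) h1 h2 <;> simp at h1 h2 ⊢
      · exact h.fn _ hx _ hy _ hz h1 h2
      · exact h'.fn _ hx _ hy _ hz h1 h2
    · rintro _ (⟨x, hx, rfl⟩ | ⟨x, hx, rfl⟩) _ (⟨y, hy, rfl⟩ | ⟨y, hy, rfl⟩) _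
        (⟨z, hz, rfl⟩ | ⟨z, hz, rfl⟩) h1 h2 <;> simp at h1 h2 ⊢
      · exact h.inj _ hx _ hy _ hz h1 h2
      · exact h'.inj _ hx _ hy _ hz h1 h2
    · rintro _ (⟨x, hx, rfl⟩ | ⟨x, hx, rfl⟩)
      · obtain ⟨y, hy, hr⟩ := h.leftE x hx
        exact ⟨_, .inl ⟨y, hy, rfl⟩, .inl hr⟩
      · obtain ⟨y, hy, hr⟩ := h'.leftE x hx
        exact ⟨_, .inr ⟨y, hy, rfl⟩, .inr hr⟩
    · rintro _ (⟨x, hx, rfl⟩ | ⟨x, hx, rfl⟩)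
      · obtain ⟨y, hy, hr⟩ := h.rightE x hx
        exact ⟨_, .inl ⟨y, hy, rfl⟩, .inl hr⟩
      · obtain ⟨y, hy, hr⟩ := h'.rightE x hx
        exact ⟨_, .inr ⟨y, hy, rfl⟩, .inr hr⟩
    · rintro _ (⟨x, hx, rfl⟩ | ⟨x, hx, rfl⟩) _ (⟨y, hy, rfl⟩ | ⟨y, hy, rfl⟩) _
        (⟨z, hz, rfl⟩ | ⟨z, hz, rfl⟩) h1 h2 <;> simp at h1 h2 ⊢
      · exact h.fnE _ hx _ hy _ hz h1 h2
      · exact h'.fnE _ hx _ hy _ hz h1 h2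
    · rintro _ (⟨x, hx, rfl⟩ | ⟨x, hx, rfl⟩) _ (⟨y, hy, rfl⟩ | ⟨y, hy, rfl⟩) _
        (⟨z, hz, rfl⟩ | ⟨z, hz, rfl⟩) h1 h2 <;> simp at h1 h2 ⊢
      · exact h.injE _ hx _ hy _ hz h1 h2
      · exact h'.injE _ hx _ hy _ hz h1 h2
    · rintro _ _ _ (⟨e, x, y, rfl, rfl, rfl, hl⟩ | ⟨e, x, y, rfl, rfl, rfl, hl⟩) _
        (⟨d, hd, rfl⟩ | ⟨d, hd, rfl⟩) _ (⟨x', hx', rfl⟩ | ⟨x', hx', rfl⟩) _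
        (⟨y', hy', rfl⟩ | ⟨y', hy', rfl⟩) h1 h2 h3 <;> simp at h1 h2 h3
      · exact .inl ⟨_, _, _, rfl, rfl, rfl, h.link _ _ _ hl _ hd _ hx' _ hy' h1 h2 h3⟩
      · exact .inr ⟨_, _, _, rfl, rfl, rfl, h'.link _ _ _ hl _ hd _ hx' _ hy' h1 h2 h3⟩
  exact this.isIso

theorem RelIso.induce {α β α' β' : Type*} {G : Graph α β} {H : Graph α' β'}
    {R : α → α' → Prop} {Q : β → β' → Prop} (h : RelIso G H R Q) {T : Set α} {T' : Set α'}
    (hT : T ⊆ V(G)) (hT' : T' ⊆ V(H))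
    (h1 : ∀ x ∈ V(G), ∀ y ∈ V(H), R x y → (x ∈ T ↔ y ∈ T')) :
    RelIso (G.induce T) (H.induce T') R Q := by
  have hE : ∀ e ∈ E(G), ∀ d ∈ E(H), Q e d → (e ∈ E(G.induce T) ↔ d ∈ E(H.induce T')) := by
    intro e he d hd hq
    obtain ⟨x, y, hl⟩ := G.exists_isLink_of_mem_edgeSet he
    obtain ⟨x', hx', hxx⟩ := h.left x hl.left_mem
    obtain ⟨y', hy', hyy⟩ := h.left y hl.right_mem
    have hl' := h.link e x y hl d hd x' hx' y' hy' hq hxx hyy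
    have a1 := h1 x hl.left_mem x' hx' hxx
    have a2 := h1 y hl.right_mem y' hy' hyy
    constructor
    · intro hh
      obtain ⟨u, v, hu⟩ := exists_isLink_of_mem_edgeSet hh
      have : x ∈ T ∧ y ∈ T := by
        rcases hl.eq_and_eq_or_eq_and_eq hu.1 with ⟨rfl, rfl⟩ | ⟨rfl, rfl⟩
        · exact hu.2
        · exact hu.2.symm
      have hh' : (H.induce T').IsLink d x' y' := ⟨hl', a1.1 this.1, a2.1 this.2⟩
      exact hh'.edge_mem
    · intro hh
      obtain ⟨u, v, hu⟩ := exists_isLink_of_mem_edgeSet hh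
      have : x' ∈ T' ∧ y' ∈ T' := by
        rcases hl'.eq_and_eq_or_eq_and_eq hu.1 with ⟨rfl, rfl⟩ | ⟨rfl, rfl⟩
        · exact hu.2
        · exact hu.2.symm
      have hh' : (G.induce T).IsLink e x y := ⟨hl, a1.2 this.1, a2.2 this.2⟩
      exact hh'.edge_mem
  have sG : ∀ e ∈ E(G.induce T), e ∈ E(G) := fun e he => (induce_le hT).edgeSet_mono he
  have sH : ∀ e ∈ E(H.induce T'), e ∈ E(H) := fun e he => (induce_le hT').edgeSet_mono he
  constructor
  · intro x hx
    obtain ⟨y, hy, hr⟩ := h.left x (hT hx)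
    exact ⟨y, (h1 x (hT hx) y hy hr).1 hx, hr⟩
  · intro y hy
    obtain ⟨x, hx, hr⟩ := h.right y (hT' hy)
    exact ⟨x, (h1 x hx y (hT' hy) hr).2 hy, hr⟩
  · exact fun x hx y hy y' hy' => h.fn x (hT hx) y (hT' hy) y' (hT' hy')
  · exact fun x hx y hy y' hy' => h.inj x (hT hx) y (hT hy) y' (hT' hy')
  · intro x hx
    obtain ⟨y, hy, hr⟩ := h.leftE x (sG _ hx)
    exact ⟨y, (hE x (sG _ hx) y hy hr).1 hx, hr⟩
  · intro y hy
    obtain ⟨x, hx, hr⟩ := h.rightE y (sH _ hy)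
    exact ⟨x, (hE x hx y (sH _ hy) hr).2 hy, hr⟩
  · exact fun x hx y hy y' hy' => h.fnE x (sG _ hx) y (sH _ hy) y' (sH _ hy')
  · exact fun x hx y hy y' hy' => h.injE x (sG _ hx) y (sG _ hy) y' (sH _ hy')
  · intro e x y hl d hd x' hx' y' hy' hq hr hr'
    exact ⟨h.link e x y hl.1 d (sH _ hd) x' (hT' hx') y' (hT' hy') hq hr hr', hx', hy'⟩

/-- The vertex set of a finite multigraph, as a finset. -/
noncomputable def verts {α β : Type*} (G : Graph α β) [Finite V(G)] : Finset α :=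
  (Set.toFinite V(G)).toFinset

@[simp]
theorem mem_verts {α β : Type*} (G : Graph α β) [Finite V(G)] {x : α} :
    x ∈ G.verts ↔ x ∈ V(G) := by
  simp [verts]

@[simp]
theorem coe_verts {α β : Type*} (G : Graph α β) [Finite V(G)] : (G.verts : Set α) = V(G) := by
  simp [verts]

theorem exists_nat_isIso {α β : Type*} (G : Graph α β) [Finite V(G)] [Finite E(G)] :
    ∃ H : Graph ℕ ℕ, Finite V(H) ∧ Finite E(H) ∧ G.IsIso H := by
  obtain ⟨f⟩ : Nonempty (V(G) ↪ ℕ) := ⟨(Finite.equivFin V(G)).toEmbedding.trans Fin.valEmbedding⟩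
  obtain ⟨g⟩ : Nonempty (E(G) ↪ ℕ) := ⟨(Finite.equivFin E(G)).toEmbedding.trans Fin.valEmbedding⟩
  refine ⟨⟨Set.range f, fun d x' y' => ∃ (e : E(G)) (x y : V(G)), g e = d ∧ f x = x' ∧ f y = y' ∧
    G.IsLink e x y, Set.range g, ?_, ?_, ?_, ?_⟩, ?_, ?_, ?_⟩
  · rintro d _
    refine ⟨?_⟩
    rintro _ _ ⟨e, x, y, rfl, rfl, rfl, h⟩
    exact ⟨e, y, x, rfl, rfl, rfl, h.symm⟩
  · rintro _ _ _ _ _ ⟨e, x, y, rfl, rfl, rfl, h⟩ ⟨e', x', y', h1, rfl, rfl, h'⟩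
    cases g.injective h1
    rcases h.left_eq_or_eq h' with h | h
    · exact .inl (congrArg f (Subtype.ext h))
    · exact .inr (congrArg f (Subtype.ext h))
  · intro d
    constructor
    · rintro ⟨e, rfl⟩
      obtain ⟨x, y, h⟩ := G.exists_isLink_of_mem_edgeSet e.2
      exact ⟨_, _, e, ⟨x, h.left_mem⟩, ⟨y, h.right_mem⟩, rfl, rfl, rfl, h⟩
    · rintro ⟨_, _, e, x, y, rfl, rfl, rfl, h⟩
      exact ⟨e, rfl⟩
  · rintro _ _ _ ⟨e, x, y, rfl, rfl, rfl, h⟩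
    exact ⟨x, rfl⟩
  · exact inferInstanceAs (Finite (Set.range f))
  · exact inferInstanceAs (Finite (Set.range g))
  · refine IsIso.of_bijective (fun x => ⟨f x, x, rfl⟩) (fun x => ⟨g x, x, rfl⟩) ⟨?_, ?_⟩ ⟨?_, ?_⟩ ?_
    · intro x y h
      exact f.injective (congrArg Subtype.val h)
    · rintro ⟨_, x, rfl⟩
      exact ⟨x, rfl⟩
    · intro x y h
      exact g.injective (congrArg Subtype.val h)
    · rintro ⟨_, x, rfl⟩
      exact ⟨x, rfl⟩
    · intro e x y h
      exact ⟨e, x, y, rfl, rfl, rfl, h⟩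

end Graph

/-- Finite multigraphs. Up to isomorphism, it is no restriction to take vertices and edges from `ℕ`
(see `Graph.exists_nat_isIso`). -/
def FinGraph : Type := {G : Graph ℕ ℕ // Finite V(G) ∧ Finite E(G)}

instance FinGraph.setoid : Setoid FinGraph where
  r G H := G.1.IsIso H.1
  iseqv := ⟨fun G => Graph.IsIso.refl G.1, Graph.IsIso.symm, Graph.IsIso.trans⟩

/-- Isomorphism classes of finite multigraphs. -/
def GraphClass : Type := Quotient FinGraph.setoid

namespace GraphClass

/-- The isomorphism class of a finite multigraph, with vertices and edges in arbitrary types. -/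
noncomputable def mk {α β : Type*} (G : Graph α β) [Finite V(G)] [Finite E(G)] : GraphClass :=
  Quotient.mk _ ⟨G.exists_nat_isIso.choose, G.exists_nat_isIso.choose_spec.1,
    G.exists_nat_isIso.choose_spec.2.1⟩

theorem mk_nat (G : FinGraph) : haveI := G.2.1; haveI := G.2.2; Quotient.mk _ G = mk G.1 := by
  have := G.2.1
  have := G.2.2
  exact Quotient.sound (G.1.exists_nat_isIso.choose_spec.2.2)

theorem mk_eq_mk {α β α' β' : Type*} {G : Graph α β} {H : Graph α' β'} [Finite V(G)] [Finite E(G)]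
    [Finite V(H)] [Finite E(H)] : mk G = mk H ↔ G.IsIso H := by
  have h1 := G.exists_nat_isIso.choose_spec.2.2
  have h2 := H.exists_nat_isIso.choose_spec.2.2
  constructor
  · intro h
    have h3 := Quotient.exact h
    exact h1.trans (Graph.IsIso.trans h3 h2.symm)
  · intro h
    exact Quotient.sound (h1.symm.trans (h.trans h2))

theorem mk_congr {α β : Type*} {G H : Graph α β} [Finite V(G)] [Finite E(G)]
    [Finite V(H)] [Finite E(H)] (h : G = H) : mk G = mk H :=
  mk_eq_mk.2 (h ▸ Graph.IsIso.refl G)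

theorem ind {p : GraphClass → Prop}
    (h : ∀ (G : Graph ℕ ℕ) [Finite V(G)] [Finite E(G)], p (mk G)) (c : GraphClass) : p c := by
  induction c using Quotient.inductionOn with
  | h G =>
    have := G.2.1
    have := G.2.2
    rw [mk_nat]
    exact h G.1

/-- The number of vertices. -/
noncomputable def numVerts (c : GraphClass) : ℕ :=
  Quotient.liftOn c (fun G => V(G.1).ncard) (fun _ _ ⟨f, _, _⟩ => Nat.card_congr f)

@[simp]
theorem numVerts_mk {α β : Type*} (G : Graph α β) [Finite V(G)] [Finite E(G)] :
    numVerts (mk G) = V(G).ncard :=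
  let ⟨f, _, _⟩ := G.exists_nat_isIso.choose_spec.2.2
  (Nat.card_congr f).symm

/-- The product of isomorphism classes is disjoint union. -/
noncomputable instance : Mul GraphClass where
  mul a b := Quotient.liftOn₂ a b
    (fun G H => haveI := G.2.1; haveI := G.2.2; haveI := H.2.1; haveI := H.2.2
      mk (G.1.disjSum H.1))
    (fun a b c d h h' => by
      have := a.2.1; have := a.2.2; have := b.2.1; have := b.2.2
      have := c.2.1; have := c.2.2; have := d.2.1; have := d.2.2
      exact mk_eq_mk.2 (Graph.IsIso.disjSum h h'))

theorem mk_mul_mk {α β α' β' : Type*} (G : Graph α β) (H : Graph α' β') [Finite V(G)] [Finite E(G)]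
    [Finite V(H)] [Finite E(H)] : mk G * mk H = mk (G.disjSum H) := by
  have h1 := G.exists_nat_isIso.choose_spec
  have h2 := H.exists_nat_isIso.choose_spec
  have := h1.1; have := h1.2.1; have := h2.1; have := h2.2.1
  exact mk_eq_mk.2 (h1.2.2.symm.disjSum h2.2.2.symm)

/-- The unit is the class of the graph without vertices. -/
noncomputable instance : One GraphClass := ⟨mk (⊥ : Graph ℕ ℕ)⟩

theorem one_def : (1 : GraphClass) = mk (⊥ : Graph ℕ ℕ) := rfl

theorem mk_eq_one {α β : Type*} {G : Graph α β} [Finite V(G)] [Finite E(G)] (h : V(G) = ∅) :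
    mk G = 1 := by
  rw [one_def, mk_eq_mk]
  have hE : ∀ e, e ∉ E(G) := fun e he => by
    obtain ⟨x, y, hl⟩ := G.exists_isLink_of_mem_edgeSet he
    simpa [h] using hl.left_mem
  exact Graph.IsIso.of_bijective (fun x => absurd x.2 (by simp [h])) (fun e => absurd e.2 (hE e))
    ⟨fun x => absurd x.2 (by simp [h]), fun x => absurd x.2 (by simp)⟩
    ⟨fun x => absurd x.2 (hE x), fun x => absurd x.2 (by simp)⟩ (fun e => absurd e.2 (hE e))

noncomputable instance : CommMonoid GraphClass where
  mul_assoc a b c := by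
    induction a using ind with | h G =>
    induction b using ind with | h H =>
    induction c using ind with | h K =>
    simp only [mk_mul_mk, mk_eq_mk]
    refine Graph.IsIso.of_bijOn (Equiv.sumAssoc _ _ _) (Equiv.sumAssoc _ _ _)
      ⟨?_, (Equiv.injective _).injOn, ?_⟩ ⟨?_, (Equiv.injective _).injOn, ?_⟩ ?_
    · rintro _ (⟨_, ⟨x, hx, rfl⟩ | ⟨x, hx, rfl⟩, rfl⟩ | ⟨x, hx, rfl⟩) <;>
        simp [Graph.disjSum, hx]
    · rintro _ (⟨x, hx, rfl⟩ | ⟨_, ⟨x, hx, rfl⟩ | ⟨x, hx, rfl⟩, rfl⟩) <;>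
        simp [Graph.disjSum, hx]
    · rintro _ (⟨_, ⟨x, hx, rfl⟩ | ⟨x, hx, rfl⟩, rfl⟩ | ⟨x, hx, rfl⟩) <;>
        simp [Graph.disjSum, hx]
    · rintro _ (⟨x, hx, rfl⟩ | ⟨_, ⟨x, hx, rfl⟩ | ⟨x, hx, rfl⟩, rfl⟩) <;>
        simp [Graph.disjSum, hx]
    · rintro _ _ _ (⟨_, _, _, rfl, rfl, rfl, (⟨_, _, _, rfl, rfl, rfl, h⟩ |
        ⟨_, _, _, rfl, rfl, rfl, h⟩)⟩ | ⟨_, _, _, rfl, rfl, rfl, h⟩) <;> simp [Graph.disjSum, h]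
  one_mul a := by
    induction a using ind with | h G =>
    simp only [one_def, mk_mul_mk, mk_eq_mk]
    refine Graph.IsIso.symm <| Graph.IsIso.of_bijOn Sum.inr Sum.inr
      ⟨?_, Sum.inr_injective.injOn, ?_⟩ ⟨?_, Sum.inr_injective.injOn, ?_⟩ ?_
    · exact fun x hx => .inr ⟨x, hx, rfl⟩
    · rintro _ (⟨_, hx, rfl⟩ | ⟨x, hx, rfl⟩)
      · simp at hx
      · exact ⟨x, hx, rfl⟩
    · exact fun x hx => .inr ⟨x, hx, rfl⟩
    · rintro _ (⟨_, hx, rfl⟩ | ⟨x, hx, rfl⟩)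
      · simp at hx
      · exact ⟨x, hx, rfl⟩
    · exact fun e x y h => .inr ⟨_, _, _, rfl, rfl, rfl, h⟩
  mul_one a := by
    induction a using ind with | h G =>
    simp only [one_def, mk_mul_mk, mk_eq_mk]
    refine Graph.IsIso.symm <| Graph.IsIso.of_bijOn Sum.inl Sum.inl
      ⟨?_, Sum.inl_injective.injOn, ?_⟩ ⟨?_, Sum.inl_injective.injOn, ?_⟩ ?_
    · exact fun x hx => .inl ⟨x, hx, rfl⟩
    · rintro _ (⟨x, hx, rfl⟩ | ⟨x, hx, rfl⟩)
      · exact ⟨x, hx, rfl⟩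
      · simp at hx
    · exact fun x hx => .inl ⟨x, hx, rfl⟩
    · rintro _ (⟨x, hx, rfl⟩ | ⟨x, hx, rfl⟩)
      · exact ⟨x, hx, rfl⟩
      · simp at hx
    · exact fun e x y h => .inl ⟨_, _, _, rfl, rfl, rfl, h⟩
  mul_comm a b := by
    induction a using ind with | h G =>
    induction b using ind with | h H =>
    simp only [mk_mul_mk, mk_eq_mk]
    refine Graph.IsIso.of_bijOn Sum.swap Sum.swap
      ⟨?_, Sum.swap_leftInverse.injective.injOn, ?_⟩ ⟨?_, Sum.swap_leftInverse.injective.injOn, ?_⟩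
      ?_
    · rintro _ (⟨x, hx, rfl⟩ | ⟨x, hx, rfl⟩) <;> simp [Graph.disjSum, hx]
    · rintro _ (⟨x, hx, rfl⟩ | ⟨x, hx, rfl⟩) <;> simp [Graph.disjSum, hx]
    · rintro _ (⟨x, hx, rfl⟩ | ⟨x, hx, rfl⟩) <;> simp [Graph.disjSum, hx]
    · rintro _ (⟨x, hx, rfl⟩ | ⟨x, hx, rfl⟩) <;> simp [Graph.disjSum, hx]
    · rintro _ _ _ (⟨_, _, _, rfl, rfl, rfl, h⟩ | ⟨_, _, _, rfl, rfl, rfl, h⟩) <;>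
        simp [Graph.disjSum, h]

theorem numVerts_mul (a b : GraphClass) : numVerts (a * b) = numVerts a + numVerts b := by
  induction a using ind with | h G =>
  induction b using ind with | h H =>
  simp only [mk_mul_mk, numVerts_mk]
  rw [Graph.disjSum, Set.ncard_union_eq, Set.ncard_image_of_injective _ Sum.inl_injective,
    Set.ncard_image_of_injective _ Sum.inr_injective]
  · exact Set.disjoint_image_inl_image_inr

theorem numVerts_one : numVerts 1 = 0 := by simp [one_def]

end GraphClass

/-- The graph algebra: the free `k`-module on the isomorphism classes of finite multigraphs. -/
def GraphAlgebra (k : Type*) [CommRing k] : Type _ := MonoidAlgebra k GraphClass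

namespace GraphAlgebra

noncomputable instance (k : Type*) [CommRing k] : CommRing (GraphAlgebra k) :=
  inferInstanceAs (CommRing (MonoidAlgebra k GraphClass))

noncomputable instance (k : Type*) [CommRing k] : Algebra k (GraphAlgebra k) :=
  inferInstanceAs (Algebra k (MonoidAlgebra k GraphClass))

/-- The basis element of the graph algebra given by an isomorphism class. -/
noncomputable def single (k : Type*) [CommRing k] : GraphClass →* GraphAlgebra k :=
  MonoidAlgebra.of k GraphClass

/-- The basis element of the graph algebra given by a finite multigraph. -/
noncomputable def of (k : Type*) [CommRing k] {α β : Type*} (G : Graph α β)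
    [Finite V(G)] [Finite E(G)] : GraphAlgebra k :=
  single k (GraphClass.mk G)

theorem linearMap_ext {k : Type*} [CommRing k] {M : Type*} [AddCommMonoid M] [Module k M]
    {φ ψ : GraphAlgebra k →ₗ[k] M}
    (h : ∀ (G : Graph ℕ ℕ) [Finite V(G)] [Finite E(G)], φ (of k G) = ψ (of k G)) : φ = ψ := by
  refine MonoidAlgebra.lhom_ext' (fun c => ?_)
  ext
  induction c using GraphClass.ind with | h G =>
  exact h G

theorem algHom_ext {k : Type*} [CommRing k] {B : Type*} [Semiring B] [Algebra k B]
    {φ ψ : GraphAlgebra k →ₐ[k] B}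
    (h : ∀ (G : Graph ℕ ℕ) [Finite V(G)] [Finite E(G)], φ (of k G) = ψ (of k G)) : φ = ψ :=
  AlgHom.toLinearMap_injective (linearMap_ext h)

/-- Extension of a function on isomorphism classes to a linear map. -/
noncomputable def extend {k : Type*} [CommRing k] {M : Type*} [AddCommMonoid M] [Module k M]
    (f : GraphClass → M) : GraphAlgebra k →ₗ[k] M :=
  Finsupp.linearCombination k f ∘ₗ
    (MonoidAlgebra.coeffLinearEquiv k : MonoidAlgebra k GraphClass ≃ₗ[k] _).toLinearMap

theorem extend_of {k : Type*} [CommRing k] {M : Type*} [AddCommMonoid M] [Module k M]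
    (f : GraphClass → M) {α β : Type*} (G : Graph α β) [Finite V(G)] [Finite E(G)] :
    extend f (of k G) = f (GraphClass.mk G) := by
  have : extend f (of k G) = Finsupp.linearCombination k f
    (MonoidAlgebra.coeff (MonoidAlgebra.single (GraphClass.mk G) (1 : k))) := rfl
  rw [this, MonoidAlgebra.coeff_single, Finsupp.linearCombination_single, one_smul]

end GraphAlgebra

open scoped Classical in
/-- The sum, over all decompositions of the vertex set of `G` into two disjoint parts, of a function
of the two induced subgraphs. -/
noncomputable def Graph.splitSum {α β M : Type*} [AddCommMonoid M] (G : Graph α β)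
    [Finite V(G)] [Finite E(G)] (t : GraphClass → GraphClass → M) : M :=
  ∑ T ∈ G.verts.powerset,
    t (GraphClass.mk (G.induce ↑T)) (GraphClass.mk (G.induce ↑(G.verts \ T)))

open scoped Classical in
theorem Graph.IsIso.splitSum_eq {α β α' β' M : Type*} [AddCommMonoid M] {G : Graph α β}
    {H : Graph α' β'} [Finite V(G)] [Finite E(G)] [Finite V(H)] [Finite E(H)] (h : G.IsIso H)
    (t : GraphClass → GraphClass → M) : G.splitSum t = H.splitSum t := by
  obtain ⟨R, Q, h⟩ := h.exists_relIso
  refine Finset.sum_bij' (fun T _ => H.verts.filter fun y => ∃ x ∈ T, R x y)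
    (fun T _ => G.verts.filter fun x => ∃ y ∈ T, R x y) ?_ ?_ ?_ ?_ ?_
  · intro T _
    simp
  · intro T _
    simp
  · intro T hT
    ext x
    simp only [Finset.mem_filter, mem_verts]
    have hT' : ∀ x ∈ T, x ∈ V(G) := fun x hx => by simpa using Finset.mem_powerset.1 hT hx
    constructor
    · rintro ⟨hx, y, ⟨hy, x', hx', h1⟩, h2⟩
      rwa [h.inj x hx x' (hT' _ hx') y hy h2 h1]
    · intro hx
      obtain ⟨y, hy, hr⟩ := h.left x (hT' _ hx)
      exact ⟨hT' _ hx, y, ⟨hy, x, hx, hr⟩, hr⟩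
  · intro T hT
    ext y
    simp only [Finset.mem_filter, mem_verts]
    have hT' : ∀ x ∈ T, x ∈ V(H) := fun x hx => by simpa using Finset.mem_powerset.1 hT hx
    constructor
    · rintro ⟨hy, x, ⟨hx, y', hy', h1⟩, h2⟩
      rwa [h.fn x hx y hy y' (hT' _ hy') h2 h1]
    · intro hy
      obtain ⟨x, hx, hr⟩ := h.right y (hT' _ hy)
      exact ⟨hT' _ hy, x, ⟨hx, y, hy, hr⟩, hr⟩
  · intro T hT
    have hT' : ∀ x ∈ T, x ∈ V(G) := fun x hx => by simpa using Finset.mem_powerset.1 hT hx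
    have key : ∀ x ∈ V(G), ∀ y ∈ V(H), R x y →
        (x ∈ T ↔ y ∈ H.verts.filter fun y => ∃ x ∈ T, R x y) := by
      intro x hx y hy hr
      simp only [Finset.mem_filter, mem_verts]
      constructor
      · exact fun hx => ⟨hy, x, hx, hr⟩
      · rintro ⟨_, x', hx', hr'⟩
        rwa [h.inj x hx x' (hT' _ hx') y hy hr hr']
    congr 1
    · rw [GraphClass.mk_eq_mk]
      refine (h.induce (fun x hx => hT' x hx) (fun y hy => ?_) key).isIso
      simpa using (Finset.mem_filter.1 (Finset.mem_coe.1 hy)).1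
    · rw [GraphClass.mk_eq_mk]
      refine (h.induce (fun x hx => ?_) (fun y hy => ?_) fun x hx y hy hr => ?_).isIso
      · simpa using (Finset.mem_sdiff.1 (Finset.mem_coe.1 hx)).1
      · simpa using (Finset.mem_sdiff.1 (Finset.mem_coe.1 hy)).1
      · have := key x hx y hy hr
        simp only [Finset.coe_sdiff, coe_verts, Set.mem_sdiff, hx, hy, true_and]
        exact not_congr this

theorem Graph.induce_induce_of_subset {α β : Type*} (G : Graph α β) {X Y : Set α} (h : Y ⊆ X) :
    (G.induce X).induce Y = G.induce Y := by
  refine Graph.ext rfl fun e x y => ?_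
  constructor
  · exact fun hl => ⟨hl.1.1, hl.2⟩
  · exact fun hl => ⟨⟨hl.1, h hl.2.1, h hl.2.2⟩, hl.2⟩

theorem Graph.verts_induce {α β : Type*} (G : Graph α β) (T : Finset α)
    [Finite V(G.induce (T : Set α))] : (G.induce (T : Set α)).verts = T := by
  ext x
  rw [mem_verts]
  exact Iff.rfl

/-- Coassociativity of splitting. -/
theorem Graph.splitSum_assoc {α β M : Type*} [AddCommMonoid M] (G : Graph α β)
    [Finite V(G)] [Finite E(G)] (t : GraphClass → GraphClass → GraphClass → M) :
    (open scoped Classical in ∑ T ∈ G.verts.powerset, (G.induce (T : Set α)).splitSum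
      fun a b => t a b (GraphClass.mk (G.induce ↑(G.verts \ T)))) =
    (open scoped Classical in ∑ T ∈ G.verts.powerset,
      (G.induce (↑(G.verts \ T) : Set α)).splitSum
      fun b c => t (GraphClass.mk (G.induce ↑T)) b c) := by
  classical
  simp only [splitSum, verts_induce]
  rw [Finset.sum_sigma', Finset.sum_sigma']
  refine Finset.sum_bij' (fun p _ => ⟨p.2, p.1 \ p.2⟩) (fun p _ => ⟨p.1 ∪ p.2, p.1⟩) ?_ ?_ ?_ ?_ ?_
  · rintro ⟨T, U⟩ h
    simp only [Finset.mem_sigma, Finset.mem_powerset] at h ⊢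
    exact ⟨h.2.trans h.1, Finset.sdiff_subset_sdiff h.1 le_rfl⟩
  · rintro ⟨T, U⟩ h
    simp only [Finset.mem_sigma, Finset.mem_powerset] at h ⊢
    exact ⟨Finset.union_subset h.1 (h.2.trans Finset.sdiff_subset), Finset.subset_union_left⟩
  · rintro ⟨T, U⟩ h
    simp only [Finset.mem_sigma, Finset.mem_powerset] at h
    simp [Finset.union_sdiff_of_subset h.2]
  · rintro ⟨T, U⟩ h
    simp only [Finset.mem_sigma, Finset.mem_powerset] at h
    have : Disjoint U T := (Finset.sdiff_disjoint).mono_left h.2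
    simp [Finset.union_sdiff_cancel_left this.symm]
  · rintro ⟨T, U⟩ h
    simp only [Finset.mem_sigma, Finset.mem_powerset] at h
    have e1 : (G.induce (T : Set α)).induce (U : Set α) = G.induce (U : Set α) :=
      G.induce_induce_of_subset (by exact_mod_cast h.2)
    have e2 : (G.induce (T : Set α)).induce (↑(T \ U) : Set α) =
        (G.induce (↑(G.verts \ U) : Set α)).induce (↑(T \ U) : Set α) := by
      rw [G.induce_induce_of_subset, G.induce_induce_of_subset]
      · exact_mod_cast Finset.sdiff_subset_sdiff h.1 le_rfl
      · exact_mod_cast Finset.sdiff_subset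
    have e4 : (G.verts \ U) \ (T \ U) = G.verts \ T := by
      ext x
      simp only [Finset.mem_sdiff]
      have := @h.2 x
      tauto
    have e3 : G.induce (↑(G.verts \ T) : Set α) =
        (G.induce (↑(G.verts \ U) : Set α)).induce (↑((G.verts \ U) \ (T \ U)) : Set α) := by
      rw [e4, G.induce_induce_of_subset]
      exact_mod_cast Finset.sdiff_subset_sdiff le_rfl h.2
    dsimp only
    rw [GraphClass.mk_congr e1, GraphClass.mk_congr e2, GraphClass.mk_congr e3]

theorem Graph.splitSum_comm {α β M : Type*} [AddCommMonoid M] (G : Graph α β)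
    [Finite V(G)] [Finite E(G)] (t : GraphClass → GraphClass → M) :
    G.splitSum t = G.splitSum (fun a b => t b a) := by
  classical
  refine Finset.sum_bij' (fun T _ => G.verts \ T) (fun T _ => G.verts \ T) ?_ ?_ ?_ ?_ ?_
  · simp
  · simp
  · intro T hT
    simpa using hT
  · intro T hT
    simpa using hT
  · intro T hT
    have e1 : G.verts \ (G.verts \ T) = T := by simpa using hT
    have e2 : G.induce (T : Set α) = G.induce (↑(G.verts \ (G.verts \ T)) : Set α) := by rw [e1]
    dsimp only
    rw [GraphClass.mk_congr e2]

open scoped Classical in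
theorem Graph.splitSum_eq_left {α β M : Type*} [AddCommMonoid M] (G : Graph α β)
    [Finite V(G)] [Finite E(G)] (t : GraphClass → GraphClass → M)
    (h : ∀ a b, a.numVerts ≠ 0 → t a b = 0) : G.splitSum t = t 1 (GraphClass.mk G) := by
  classical
  rw [splitSum, Finset.sum_eq_single ∅]
  · congr 1
    · exact GraphClass.mk_eq_one (by simp)
    · exact GraphClass.mk_congr (by simp)
  · intro T _ hT
    apply h
    rw [GraphClass.numVerts_mk]
    simpa using hT
  · simp

/-- Splitting is compatible with disjoint unions. -/
theorem Graph.splitSum_disjSum {α β α' β' M : Type*} [AddCommMonoid M] (G : Graph α β)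
    (H : Graph α' β') [Finite V(G)] [Finite E(G)] [Finite V(H)] [Finite E(H)]
    (t : GraphClass → GraphClass → M) :
    (G.disjSum H).splitSum t =
      G.splitSum fun a b => H.splitSum fun c d => t (a * c) (b * d) := by
  classical
  have hv : (G.disjSum H).verts = G.verts.disjSum H.verts := by
    ext x
    cases x <;> simp [Graph.disjSum]
  have key : ∀ (A : Finset α) (B : Finset α'),
      (G.disjSum H).induce (↑(A.disjSum B) : Set (α ⊕ α')) =
        (G.induce (A : Set α)).disjSum (H.induce (B : Set α')) := by
    intro A B
    refine Graph.ext ?_ fun e x y => ?_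
    · ext x
      cases x <;> simp [Graph.disjSum]
    · constructor
      · rintro ⟨⟨e, x, y, rfl, rfl, rfl, hl⟩ | ⟨e, x, y, rfl, rfl, rfl, hl⟩, h1, h2⟩
        · exact .inl ⟨_, _, _, rfl, rfl, rfl, hl, by simpa using h1, by simpa using h2⟩
        · exact .inr ⟨_, _, _, rfl, rfl, rfl, hl, by simpa using h1, by simpa using h2⟩
      · rintro (⟨e, x, y, rfl, rfl, rfl, hl⟩ | ⟨e, x, y, rfl, rfl, rfl, hl⟩)
        · exact ⟨.inl ⟨_, _, _, rfl, rfl, rfl, hl.1⟩, by simpa using hl.2.1, by simpa using hl.2.2⟩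
        · exact ⟨.inr ⟨_, _, _, rfl, rfl, rfl, hl.1⟩, by simpa using hl.2.1, by simpa using hl.2.2⟩
  simp only [splitSum, GraphClass.mk_mul_mk]
  rw [Finset.sum_sigma']
  refine Finset.sum_bij' (fun T _ => ⟨T.toLeft, T.toRight⟩) (fun p _ => p.1.disjSum p.2)
    ?_ ?_ ?_ ?_ ?_
  · intro T hT
    rw [hv, Finset.mem_powerset] at hT
    simp only [Finset.mem_sigma, Finset.mem_powerset]
    constructor
    · intro x hx
      simpa using hT (Finset.mem_toLeft.1 hx)
    · intro x hx
      simpa using hT (Finset.mem_toRight.1 hx)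
  · rintro ⟨A, B⟩ h
    simp only [Finset.mem_sigma, Finset.mem_powerset] at h ⊢
    rw [hv]
    exact Finset.disjSum_mono h.1 h.2
  · intro T _
    ext x
    cases x <;> simp
  · rintro ⟨A, B⟩ _
    simp
  · intro T _
    have e1 : T = T.toLeft.disjSum T.toRight := by
      ext x
      cases x <;> simp
    have e2 : (G.disjSum H).verts \ T =
        (G.verts \ T.toLeft).disjSum (H.verts \ T.toRight) := by
      rw [hv]
      ext x
      cases x <;> simp
    have e3 : (G.disjSum H).induce (T : Set (α ⊕ α')) =
      (G.induce (T.toLeft : Set α)).disjSum (H.induce (T.toRight : Set α')) := by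
      rw [← key, ← e1]
    have e4 : (G.disjSum H).induce (↑((G.disjSum H).verts \ T) : Set (α ⊕ α')) =
      (G.induce (↑(G.verts \ T.toLeft) : Set α)).disjSum
        (H.induce (↑(H.verts \ T.toRight) : Set α')) := by
      rw [← key, ← e2]
    rw [GraphClass.mk_congr e3]
    exact congrArg _ (GraphClass.mk_congr (by convert! e4))

namespace GraphAlgebra

/-- The function of which the comultiplication is the linear extension. -/
noncomputable def comulFun (k : Type*) [CommRing k] (c : GraphClass) :
    GraphAlgebra k ⊗[k] GraphAlgebra k :=
  Quotient.liftOn c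
    (fun G => have := G.2.1; have := G.2.2; G.1.splitSum fun a b => single k a ⊗ₜ[k] single k b)
    (fun G H h => by
      have := G.2.1; have := G.2.2; have := H.2.1; have := H.2.2
      exact Graph.IsIso.splitSum_eq h _)

theorem comulFun_mk (k : Type*) [CommRing k] {α β : Type*} (G : Graph α β)
    [Finite V(G)] [Finite E(G)] :
    comulFun k (GraphClass.mk G) = G.splitSum fun a b => single k a ⊗ₜ[k] single k b := by
  have h := G.exists_nat_isIso.choose_spec
  have := h.1; have := h.2.1
  exact (h.2.2.splitSum_eq fun a b => single k a ⊗ₜ[k] single k b).symm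

/-- The comultiplication `G ↦ ∑ T ⊆ V(G), G|T ⊗ G|(V(G) \ T)`, as an algebra homomorphism. -/
noncomputable def comulHom (k : Type*) [CommRing k] :
    GraphAlgebra k →ₐ[k] GraphAlgebra k ⊗[k] GraphAlgebra k :=
  MonoidAlgebra.lift k _ GraphClass
    { toFun := comulFun k
      map_one' := by
        rw [GraphClass.one_def, comulFun_mk, Graph.splitSum, Finset.sum_eq_single ∅]
        · rw [GraphClass.mk_eq_one (by simp), GraphClass.mk_eq_one, map_one]
          · rfl
          · simp
        · intro T hT hT'
          have : T ⊆ ∅ := fun x hx => by simpa using Finset.mem_powerset.1 hT hx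
          exact absurd (Finset.subset_empty.1 this) hT'
        · simp
      map_mul' := fun a b => by
        induction a using GraphClass.ind with | h G =>
        induction b using GraphClass.ind with | h H =>
        rw [GraphClass.mk_mul_mk, comulFun_mk, comulFun_mk, comulFun_mk, Graph.splitSum_disjSum,
          Graph.splitSum, Graph.splitSum, Finset.sum_mul]
        refine Finset.sum_congr rfl fun T _ => ?_
        rw [Graph.splitSum, Graph.splitSum, Finset.mul_sum]
        refine Finset.sum_congr rfl fun U _ => ?_
        rw [Algebra.TensorProduct.tmul_mul_tmul, map_mul, map_mul] }

theorem comulHom_of (k : Type*) [CommRing k] {α β : Type*} (G : Graph α β)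
    [Finite V(G)] [Finite E(G)] :
    comulHom k (of k G) = G.splitSum fun a b => single k a ⊗ₜ[k] single k b := by
  rw [← comulFun_mk]
  exact MonoidAlgebra.lift_of _ _

/-- The counit: `1` on the graph without vertices, `0` on all others. -/
noncomputable def counitHom (k : Type*) [CommRing k] : GraphAlgebra k →ₐ[k] k :=
  MonoidAlgebra.lift k _ GraphClass
    { toFun := fun c => if c.numVerts = 0 then 1 else 0
      map_one' := by simp [GraphClass.numVerts_one]
      map_mul' := fun a b => by
        rw [GraphClass.numVerts_mul]
        by_cases ha : a.numVerts = 0 <;> by_cases hb : b.numVerts = 0 <;> simp [ha, hb] }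

theorem counitHom_single (k : Type*) [CommRing k] (c : GraphClass) :
    counitHom k (single k c) = if c.numVerts = 0 then 1 else 0 :=
  MonoidAlgebra.lift_of _ _

noncomputable instance (k : Type*) [CommRing k] : Bialgebra k (GraphAlgebra k) :=
  Bialgebra.ofAlgHom (comulHom k) (counitHom k)
    (by
      refine algHom_ext fun G _ _ => ?_
      have key := G.splitSum_assoc
        (fun a b c => single k a ⊗ₜ[k] (single k b ⊗ₜ[k] single k c))
      simp only [AlgHom.comp_apply, comulHom_of]
      simp only [Graph.splitSum, map_sum, Algebra.TensorProduct.map_tmul, AlgHom.id_apply] at key ⊢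
      refine Eq.trans (Finset.sum_congr rfl fun T _ => ?_)
        (key.trans (Finset.sum_congr rfl fun T _ => ?_))
      · have := comulHom_of k (G.induce (T : Set ℕ))
        rw [of] at this
        rw [this]
        simp only [Graph.splitSum, TensorProduct.sum_tmul, map_sum]
        rfl
      · refine Eq.trans ?_ (congrArg _ (comulHom_of k _).symm)
        simp only [Graph.splitSum, TensorProduct.tmul_sum])
    (by
      refine algHom_ext fun G _ _ => ?_
      have key := G.splitSum_eq_left
        (fun a b => (counitHom k (single k a)) ⊗ₜ[k] single k b)
        (fun a b h => by rw [counitHom_single, if_neg h, TensorProduct.zero_tmul])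
      simp only [AlgHom.comp_apply, comulHom_of]
      simp only [Graph.splitSum, map_sum, Algebra.TensorProduct.map_tmul, AlgHom.id_apply] at key ⊢
      rw [key, map_one, map_one]
      rfl)
    (by
      refine algHom_ext fun G _ _ => ?_
      have key := G.splitSum_eq_left
        (fun a b => single k b ⊗ₜ[k] (counitHom k (single k a)))
        (fun a b h => by rw [counitHom_single, if_neg h, TensorProduct.tmul_zero])
      rw [Graph.splitSum_comm] at key
      simp only [AlgHom.comp_apply, comulHom_of]
      simp only [Graph.splitSum, map_sum, Algebra.TensorProduct.map_tmul, AlgHom.id_apply] at key ⊢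
      rw [key, map_one, map_one]
      rfl)

theorem comul_of (k : Type*) [CommRing k] {α β : Type*} (G : Graph α β)
    [Finite V(G)] [Finite E(G)] : Coalgebra.comul (R := k) (of k G) =
      open scoped Classical in ∑ T ∈ G.verts.powerset,
        of k (G.induce ↑T) ⊗ₜ[k] of k (G.induce ↑(G.verts \ T)) :=
  comulHom_of k G

theorem counit_of (k : Type*) [CommRing k] {α β : Type*} (G : Graph α β)
    [Finite V(G)] [Finite E(G)] :
    Coalgebra.counit (R := k) (of k G) = if V(G).ncard = 0 then 1 else 0 :=
  (counitHom_single k _).trans (by rw [GraphClass.numVerts_mk])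

theorem of_mul_of (k : Type*) [CommRing k] {α β α' β' : Type*} (G : Graph α β) (H : Graph α' β')
    [Finite V(G)] [Finite E(G)] [Finite V(H)] [Finite E(H)] :
    of k G * of k H = of k (G.disjSum H) := by
  rw [of, of, of, ← map_mul, GraphClass.mk_mul_mk]

open scoped Classical in
theorem convMul_of {k : Type*} [CommRing k]
    (φ ψ : WithConv (GraphAlgebra k →ₗ[k] GraphAlgebra k)) {α β : Type*} (G : Graph α β)
    [Finite V(G)] [Finite E(G)] :
    (φ * ψ) (of k G) = ∑ T ∈ G.verts.powerset,
      φ (of k (G.induce ↑T)) * ψ (of k (G.induce ↑(G.verts \ T))) := by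
  rw [LinearMap.convMul_apply, comul_of, map_sum, map_sum]
  rfl

/-- The reduced identity `u ∘ ε - id` in the convolution algebra. -/
noncomputable def negReduced (k : Type*) [CommRing k] :
    WithConv (GraphAlgebra k →ₗ[k] GraphAlgebra k) :=
  1 - WithConv.toConv LinearMap.id

theorem negReduced_of {k : Type*} [CommRing k] {α β : Type*} (G : Graph α β)
    [Finite V(G)] [Finite E(G)] (h : V(G).ncard = 0) : negReduced k (of k G) = 0 := by
  have h1 : V(G) = ∅ := (Set.ncard_eq_zero).1 h
  have : negReduced k (of k G) =
    algebraMap k _ (Coalgebra.counit (R := k) (of k G)) - of k G := rfl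
  rw [this, counit_of, if_pos h, map_one, of, GraphClass.mk_eq_one h1, map_one, sub_self]

theorem negReduced_pow_of {k : Type*} [CommRing k] (n : ℕ) {α β : Type*} (G : Graph α β)
    [Finite V(G)] [Finite E(G)] (h : V(G).ncard < n) : (negReduced k ^ n) (of k G) = 0 := by
  classical
  induction n generalizing α β G with
  | zero => omega
  | succ n ih =>
    rw [pow_succ', convMul_of]
    refine Finset.sum_eq_zero fun T hT => ?_
    by_cases hT0 : T = ∅
    · rw [negReduced_of, zero_mul]
      simp [hT0]
    · have : V(G.induce (↑(G.verts \ T) : Set α)).ncard < n := by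
        have h1 : V(G.induce (↑(G.verts \ T) : Set α)) = ↑(G.verts \ T) := rfl
        have h2 : V(G).ncard = G.verts.card := by
          rw [← Set.ncard_coe_finset, Graph.coe_verts]
        have h3 := Finset.card_sdiff_add_card_eq_card (Finset.mem_powerset.1 hT)
        have h4 := Finset.card_pos.2 (Finset.nonempty_iff_ne_empty.2 hT0)
        rw [h1, Set.ncard_coe_finset]
        omega
      rw [ih _ this, mul_zero]

theorem conv_sum_apply {k : Type*} [CommRing k] {ι : Type*} (s : Finset ι)
    (φ : ι → WithConv (GraphAlgebra k →ₗ[k] GraphAlgebra k)) (x : GraphAlgebra k) :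
    (∑ i ∈ s, φ i) x = ∑ i ∈ s, φ i x := by
  classical
  induction s using Finset.induction_on with
  | empty => rfl
  | insert a s ha ih =>
    rw [Finset.sum_insert ha, Finset.sum_insert ha, ← ih]
    rfl

/-- The antipode, given by the geometric series of `u ∘ ε - id` in the convolution algebra; on a
graph with `n` vertices the terms of index above `n` vanish. -/
noncomputable def antipodeMap (k : Type*) [CommRing k] : GraphAlgebra k →ₗ[k] GraphAlgebra k :=
  extend fun c => (∑ i ∈ Finset.range (c.numVerts + 1), negReduced k ^ i) (single k c)

theorem antipodeMap_of {k : Type*} [CommRing k] (n : ℕ) {α β : Type*} (G : Graph α β)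
    [Finite V(G)] [Finite E(G)] (h : V(G).ncard ≤ n) :
    antipodeMap k (of k G) = (∑ i ∈ Finset.range (n + 1), negReduced k ^ i) (of k G) := by
  rw [antipodeMap, extend_of, conv_sum_apply, conv_sum_apply, GraphClass.numVerts_mk]
  refine Finset.sum_subset (Finset.range_mono (by omega)) fun i _ hi => ?_
  exact negReduced_pow_of i G (by simpa using hi)

theorem ncard_induce_le {α β : Type*} (G : Graph α β) [Finite V(G)] {T : Finset α}
    (hT : T ⊆ G.verts) : V(G.induce (T : Set α)).ncard ≤ V(G).ncard :=
  Set.ncard_le_ncard (fun x hx => by simpa using hT hx) (Set.toFinite _)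

theorem antipode_left (k : Type*) [CommRing k] :
    WithConv.toConv (antipodeMap k) * WithConv.toConv LinearMap.id =
      (1 : WithConv (GraphAlgebra k →ₗ[k] GraphAlgebra k)) := by
  refine WithConv.ext (linearMap_ext fun G _ _ => ?_)
  change (WithConv.toConv (antipodeMap k) * WithConv.toConv LinearMap.id : WithConv (GraphAlgebra k →ₗ[k] GraphAlgebra k))
      (of k G) =
    (1 : WithConv (GraphAlgebra k →ₗ[k] GraphAlgebra k)) (of k G)
  have h1 : (WithConv.toConv (antipodeMap k) * WithConv.toConv LinearMap.id : WithConv (GraphAlgebra k →ₗ[k] GraphAlgebra k))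
      (of k G) =
      ((∑ i ∈ Finset.range (V(G).ncard + 1), negReduced k ^ i) *
        WithConv.toConv LinearMap.id : WithConv (GraphAlgebra k →ₗ[k] GraphAlgebra k)) (of k G) := by
    rw [convMul_of, convMul_of]
    refine Finset.sum_congr rfl fun T hT => ?_
    rw [← antipodeMap_of _ _ (ncard_induce_le G (Finset.mem_powerset.1 hT))]
  have h2 : (WithConv.toConv LinearMap.id : WithConv (GraphAlgebra k →ₗ[k] GraphAlgebra k)) = 1 - negReduced k := by simp [negReduced]
  rw [h1, h2, geom_sum_mul_neg]
  change _ - (negReduced k ^ (V(G).ncard + 1)) (of k G) = _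
  rw [negReduced_pow_of _ G (Nat.lt_succ_self _), sub_zero]
  rfl

theorem antipode_right (k : Type*) [CommRing k] :
    WithConv.toConv LinearMap.id * WithConv.toConv (antipodeMap k) =
      (1 : WithConv (GraphAlgebra k →ₗ[k] GraphAlgebra k)) := by
  refine WithConv.ext (linearMap_ext fun G _ _ => ?_)
  change (WithConv.toConv LinearMap.id * WithConv.toConv (antipodeMap k) : WithConv (GraphAlgebra k →ₗ[k] GraphAlgebra k))
      (of k G) =
    (1 : WithConv (GraphAlgebra k →ₗ[k] GraphAlgebra k)) (of k G)
  have h1 : (WithConv.toConv LinearMap.id * WithConv.toConv (antipodeMap k) : WithConv (GraphAlgebra k →ₗ[k] GraphAlgebra k))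
      (of k G) =
      (WithConv.toConv LinearMap.id *
        (∑ i ∈ Finset.range (V(G).ncard + 1), negReduced k ^ i) :
          WithConv (GraphAlgebra k →ₗ[k] GraphAlgebra k)) (of k G) := by
    rw [convMul_of, convMul_of]
    refine Finset.sum_congr rfl fun T hT => ?_
    exact congrArg _ (antipodeMap_of _ _ (ncard_induce_le G (@Finset.sdiff_subset _ (_) _ _)))
  have h2 : (WithConv.toConv LinearMap.id : WithConv (GraphAlgebra k →ₗ[k] GraphAlgebra k)) = 1 - negReduced k := by simp [negReduced]
  rw [h1, h2, mul_neg_geom_sum]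
  change _ - (negReduced k ^ (V(G).ncard + 1)) (of k G) = _
  rw [negReduced_pow_of _ G (Nat.lt_succ_self _), sub_zero]
  rfl

/-- The graph Hopf algebra. -/
noncomputable instance (k : Type*) [CommRing k] : HopfAlgebra k (GraphAlgebra k) where
  antipode := antipodeMap k
  mul_antipode_rTensor_comul := congrArg WithConv.ofConv (antipode_left k)
  mul_antipode_lTensor_comul := congrArg WithConv.ofConv (antipode_right k)

end GraphAlgebra

namespace Graph

/-- `x` and `y` are joined by a path (possibly trivial) of `G`. -/
def Reachable {α β : Type*} (G : Graph α β) (x y : α) : Prop :=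
  Relation.ReflTransGen G.Adj x y

/-- A multigraph is acyclic if it has no cycle `v 0, e 0, v 1, e 1, …, v k, e k, v 0` with distinct
vertices and distinct edges. A loop is a cycle of length `1`, two parallel edges form a cycle of
length `2`. -/
def IsAcyclic {α β : Type*} (G : Graph α β) : Prop :=
  ¬ ∃ (k : ℕ) (v : Fin (k + 1) → α) (e : Fin (k + 1) → β),
    Function.Injective v ∧ Function.Injective e ∧ ∀ i, G.IsLink (e i) (v i) (v (i + 1))

/-- The rank of a set `A` of edges: the largest size of an acyclic subset of `A`. -/
noncomputable def rk {α β : Type*} (G : Graph α β) (A : Set β) : ℕ :=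
  sSup {n | ∃ B ⊆ A, B ⊆ E(G) ∧ (G.restrict B).IsAcyclic ∧ B.ncard = n}

/-- A set `A` of edges is a flat if it contains every edge whose endpoints are joined by a path
in `A`. -/
def IsFlat {α β : Type*} (G : Graph α β) (A : Set β) : Prop :=
  A ⊆ E(G) ∧ ∀ e x y, G.IsLink e x y → (G.restrict A).Reachable x y → e ∈ A

/-- The finite set of flats of a multigraph with finitely many edges. -/
noncomputable def flats {α β : Type*} (G : Graph α β) [Finite E(G)] : Finset (Set β) :=
  ((Set.toFinite E(G)).finite_subsets.subset
    (show {A | G.IsFlat A} ⊆ {A | A ⊆ E(G)} from fun _ hA => hA.1)).toFinset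

@[simp]
theorem mem_flats {α β : Type*} (G : Graph α β) [Finite E(G)] {A : Set β} :
    A ∈ G.flats ↔ G.IsFlat A := by
  simp [flats]

/-- The contraction `G / A`: the edges of `A` are removed and every connected component of the
spanning subgraph with edge set `A` is identified to a single vertex. The new vertex is represented
by the vertex set of the component. -/
def contract {α β : Type*} (G : Graph α β) (A : Set β) : Graph (Set α) β :=
  (G.deleteEdges A).map fun x => {y | (G.restrict A).Reachable x y}

/-- An orientation: each edge gets one of its endpoints as its tail (first component) and the other
one as its head (second component). -/
def Orientation {α β : Type*} (G : Graph α β) : Type _ :=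
  {o : E(G) → α × α // ∀ e : E(G), G.IsLink e (o e).1 (o e).2}

/-- An orientation is acyclic if no nonempty directed walk returns to its starting point. -/
def Orientation.IsAcyclic {α β : Type*} {G : Graph α β} (o : G.Orientation) : Prop :=
  ∀ x, ¬ Relation.TransGen (fun u v => ∃ e : E(G), o.1 e = (u, v)) x x

/-- The number of acyclic orientations. -/
noncomputable def numAcyclicOrientations {α β : Type*} (G : Graph α β) : ℕ :=
  Nat.card {o : G.Orientation // o.IsAcyclic}

end Graph

/-! The antipode is the convolution inverse of the identity, so on a graph with at least one vertex
the sum over `T` of `G|T · S(G|(V \ T))` vanishes. The term `T = ∅` is `S(G)` and all other terms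
involve fewer vertices, so this recursion determines `S`. It remains to see that the flat expansion
satisfies it (`sum_of_induce_mul_flatSum`).

Expanding the right factor gives a sum over pairs `(T, F)` with `F` a flat of `G|(V \ T)`, and the
product of the two graphs is the spanning subgraph of `G` with edge set `A = E(G|T) ∪ F`. This `A`
is a flat of `G`, and `(T, F)` can be recovered from `(A, T)`; the sets `T` that occur for a given
`A` are the unions of `A`-components with `E(G|T) ⊆ A`. These correspond to the independent vertex
sets of `H = G/A`, and contracting `F` in `G|(V \ T)` yields `H` with the image of `T` deleted.
Since `n - rk` counts the vertices of a contraction (`rk_add_ncard_vertexSet_contract`), the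
coefficient of the subgraph is the sum of `(-1)^|V(H) \ T| a(H - T)` over independent `T` in `H`.

This sum is zero (`sum_neg_one_pow_mul_numAcyclicOrientations`). An acyclic orientation of `H - T`
extends uniquely to one of `H` in which every vertex of `T` is a source, so the sum runs over pairs
of an acyclic orientation of `H` and a subset `T` of its sources, with sign `(-1)^|V(H) \ T|`. For a
fixed orientation the set of sources is nonempty, and the alternating sum over its subsets cancels.
-/

namespace Graph

/-! ### Acyclic orientations with prescribed sources -/

section Orientations

variable {γ β : Type*}

/-- The arcs of an orientation, as a relation on vertices. -/
def Orientation.Arc {H : Graph γ β} (o : H.Orientation) (u v : γ) : Prop :=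
  ∃ e : E(H), o.1 e = (u, v)

/-- No vertex of `T` is the head of an edge. -/
def Orientation.AvoidsHeads {H : Graph γ β} (o : H.Orientation) (T : Set γ) : Prop :=
  ∀ e : E(H), (o.1 e).2 ∉ T

instance finite_orientation (H : Graph γ β) [Finite V(H)] [Finite E(H)] :
    Finite H.Orientation := by
  refine Finite.of_injective (β := E(H) → V(H) × V(H))
    (fun o e => (⟨(o.1 e).1, (o.2 e).left_mem⟩, ⟨(o.1 e).2, (o.2 e).right_mem⟩)) ?_
  intro o o' h
  refine Subtype.ext (funext fun e => ?_)
  have := congrFun h e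
  simp only [Prod.mk.injEq, Subtype.mk.injEq] at this
  exact Prod.ext this.1 this.2

/-- Acyclicity makes the transitive closure of the arcs a strict order on the finite vertex set; a
minimal vertex is a source. -/
theorem Orientation.IsAcyclic.exists_source {H : Graph γ β} [Finite V(H)] {o : H.Orientation}
    (ho : o.IsAcyclic) (hne : V(H).Nonempty) : ∃ x ∈ V(H), ∀ e : E(H), (o.1 e).2 ≠ x := by
  let r : V(H) → V(H) → Prop := fun u v => Relation.TransGen o.Arc u v
  have h1 : IsTrans V(H) r := ⟨fun _ _ _ => Relation.TransGen.trans⟩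
  have h2 : Std.Irrefl r := ⟨fun x => ho x⟩
  have hwf : WellFounded r := Finite.wellFounded_of_trans_of_irrefl r
  obtain ⟨x, hx⟩ := hne
  obtain ⟨m, -, hm⟩ := hwf.has_min Set.univ ⟨⟨x, hx⟩, trivial⟩
  refine ⟨m, m.2, fun e he => ?_⟩
  refine hm ⟨(o.1 e).1, (o.2 e).left_mem⟩ trivial (Relation.TransGen.single ⟨e, ?_⟩)
  exact Prod.ext rfl he

theorem mem_edgeSet_induce_of_isLink {H : Graph γ β} {X : Set γ} {e : β} {x y : γ}
    (h : H.IsLink e x y) : e ∈ E(H.induce X) ↔ x ∈ X ∧ y ∈ X := by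
  constructor
  · intro he
    obtain ⟨u, v, hl⟩ := exists_isLink_of_mem_edgeSet he
    rcases h.eq_and_eq_or_eq_and_eq hl.1 with ⟨rfl, rfl⟩ | ⟨rfl, rfl⟩
    · exact hl.2
    · exact hl.2.symm
  · intro hx
    exact IsLink.edge_mem (show (H.induce X).IsLink e x y from ⟨h, hx⟩)

theorem edgeSet_induce_subset (H : Graph γ β) (X : Set γ) : E(H.induce X) ⊆ E(H) := by
  intro e he
  obtain ⟨u, v, hl⟩ := exists_isLink_of_mem_edgeSet he
  exact hl.1.edge_mem

/-- Restriction of an orientation to an induced subgraph. -/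
def Orientation.restrictInduce {H : Graph γ β} (o : H.Orientation) (X : Set γ) :
    (H.induce X).Orientation :=
  ⟨fun e => o.1 ⟨e, edgeSet_induce_subset H X e.2⟩, fun e =>
    ⟨o.2 ⟨e, edgeSet_induce_subset H X e.2⟩,
      (mem_edgeSet_induce_of_isLink (o.2 ⟨e, edgeSet_induce_subset H X e.2⟩)).1 e.2⟩⟩

theorem Orientation.IsAcyclic.restrictInduce {H : Graph γ β} {o : H.Orientation}
    (ho : o.IsAcyclic) (X : Set γ) : (o.restrictInduce X).IsAcyclic :=
  fun x hx => ho x (Relation.TransGen.mono (fun _ _ ⟨_, he⟩ => ⟨_, he⟩) _ _ hx)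

/-- An edge not contained in the complement of `T` has exactly one end in `T`, because `T` is
independent, and can be directed away from that end. -/
theorem Orientation.exists_extend {H : Graph γ β} {T : Set γ} (hT : E(H.induce T) = ∅)
    (o : (H.induce (V(H) \ T)).Orientation) :
    ∃ o' : H.Orientation, o'.AvoidsHeads T ∧ o'.restrictInduce (V(H) \ T) = o := by
  classical
  have key : ∀ e : E(H), ∃ p : γ × γ, H.IsLink e p.1 p.2 ∧ p.2 ∉ T ∧
      ∀ he : e.1 ∈ E(H.induce (V(H) \ T)), o.1 ⟨e, he⟩ = p := by
    rintro ⟨e, he⟩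
    by_cases h : e ∈ E(H.induce (V(H) \ T))
    · exact ⟨o.1 ⟨e, h⟩, (o.2 ⟨e, h⟩).1, (o.2 ⟨e, h⟩).2.2.2, fun _ => rfl⟩
    · obtain ⟨x, y, hl⟩ := exists_isLink_of_mem_edgeSet he
      have h1 := (mem_edgeSet_induce_of_isLink (X := V(H) \ T) hl).not.1 h
      have h2 := (mem_edgeSet_induce_of_isLink (X := T) hl).not.1 (by simp [hT])
      have hx := hl.left_mem
      have hy := hl.right_mem
      simp only [Set.mem_sdiff, hx, hy, true_and] at h1
      by_cases hyT : y ∈ T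
      · exact ⟨(y, x), hl.symm, fun hxT => h2 ⟨hxT, hyT⟩, fun h' => absurd h' h⟩
      · exact ⟨(x, y), hl, hyT, fun h' => absurd h' h⟩
  choose p hp hpT hpo using key
  exact ⟨⟨p, hp⟩, hpT, Subtype.ext (funext fun e => (hpo ⟨e, _⟩ e.2).symm)⟩

/-- A directed walk never enters `T`, so a closed one lives entirely in the complement. -/
theorem Orientation.AvoidsHeads.isAcyclic {H : Graph γ β} {T : Set γ} {o : H.Orientation}
    (ho : o.AvoidsHeads T) (h : (o.restrictInduce (V(H) \ T)).IsAcyclic) : o.IsAcyclic := by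
  have key : ∀ u v, u ∉ T → Relation.TransGen o.Arc u v →
      v ∉ T ∧ Relation.TransGen (o.restrictInduce (V(H) \ T)).Arc u v := by
    have step : ∀ u v, u ∉ T → o.Arc u v → v ∉ T ∧ (o.restrictInduce (V(H) \ T)).Arc u v := by
      rintro u v hu ⟨e, he⟩
      have hl := o.2 e
      have hv := ho e
      rw [he] at hl hv
      exact ⟨hv, ⟨e, (mem_edgeSet_induce_of_isLink hl).2
        ⟨⟨hl.left_mem, hu⟩, ⟨hl.right_mem, hv⟩⟩⟩, he⟩
    intro u v hu huv
    induction huv with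
    | single h => exact (step _ _ hu h).imp_right .single
    | tail _ h ih => exact (step _ _ ih.1 h).imp_right ih.2.tail
  intro x hx
  -- The base point of a closed walk is the head of its last arc.
  have hxT : x ∉ T := by
    obtain ⟨u, -, e, he⟩ := Relation.TransGen.tail'_iff.1 hx
    have := ho e
    rwa [he] at this
  exact h x (key x x hxT hx).2

/-- An edge that the restriction does not see has an end in `T`, which must be its tail in both
orientations. -/
theorem Orientation.AvoidsHeads.eq_of_restrictInduce_eq {H : Graph γ β} {T : Set γ}
    {o o' : H.Orientation} (ho : o.AvoidsHeads T) (ho' : o'.AvoidsHeads T)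
    (h : o.restrictInduce (V(H) \ T) = o'.restrictInduce (V(H) \ T)) : o = o' := by
  refine Subtype.ext (funext fun e => ?_)
  by_cases he : e.1 ∈ E(H.induce (V(H) \ T))
  · exact congrFun (congrArg Subtype.val h) ⟨e, he⟩
  · have h1 := (mem_edgeSet_induce_of_isLink (o.2 e)).not.1 he
    have h2 := ho e
    have h3 := ho' e
    have h4 := (o.2 e).left_mem
    have h5 := (o.2 e).right_mem
    rcases (o.2 e).eq_and_eq_or_eq_and_eq (o'.2 e) with h | h
    · exact Prod.ext h.1 h.2
    · simp only [Set.mem_sdiff, h4, h5, true_and, h2, not_false_eq_true, and_true, not_not] at h1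
      exact absurd (h.1 ▸ h1) h3

theorem card_avoidsHeads {H : Graph γ β} {T : Set γ} (hT : E(H.induce T) = ∅) :
    Nat.card {o : {o : H.Orientation // o.IsAcyclic} // o.1.AvoidsHeads T} =
      (H.induce (V(H) \ T)).numAcyclicOrientations := by
  refine Nat.card_eq_of_bijective
    (fun o => ⟨o.1.1.restrictInduce (V(H) \ T), o.1.2.restrictInduce _⟩) ⟨?_, ?_⟩
  · intro o o' h
    exact Subtype.ext (Subtype.ext (o.2.eq_of_restrictInduce_eq o'.2 (congrArg Subtype.val h)))
  · rintro ⟨o, ho⟩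
    obtain ⟨o', h1, rfl⟩ := Orientation.exists_extend hT o
    exact ⟨⟨⟨o', h1.isAcyclic ho⟩, h1⟩, rfl⟩

/-- An edge inside `T` has its head in `T`. Thus the independence condition on `T` may be dropped
once orientations of the whole graph are counted. -/
theorem card_avoidsHeads_eq_zero {H : Graph γ β} {T : Set γ} (hT : E(H.induce T) ≠ ∅) :
    Nat.card {o : {o : H.Orientation // o.IsAcyclic} // o.1.AvoidsHeads T} = 0 := by
  obtain ⟨e, he⟩ := Set.nonempty_iff_ne_empty.2 hT
  have : IsEmpty {o : {o : H.Orientation // o.IsAcyclic} // o.1.AvoidsHeads T} := by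
    refine ⟨fun o => o.2 ⟨e, edgeSet_induce_subset _ _ he⟩ ?_⟩
    exact ((mem_edgeSet_induce_of_isLink (o.1.1.2 _)).1 he).2
  exact Nat.card_of_isEmpty

open scoped Classical in
/-- The alternating sum of the numbers of acyclic orientations of the graphs obtained by deleting
independent sets of vertices vanishes. -/
theorem sum_neg_one_pow_mul_numAcyclicOrientations {R : Type*} [CommRing R] (H : Graph γ β)
    [Finite V(H)] [Finite E(H)] (hne : V(H).Nonempty) :
    ∑ T ∈ H.verts.powerset.filter fun T : Finset γ => E(H.induce (T : Set γ)) = ∅, (-1 : R) ^ (V(H) \ T).ncard *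
      ((H.induce (V(H) \ T)).numAcyclicOrientations : R) = 0 := by
  have := Fintype.ofFinite {o : H.Orientation // o.IsAcyclic}
  -- Each term becomes a sum over the acyclic orientations of `H` itself, so that the two summations
  -- can be exchanged.
  have h1 : ∀ T ∈ H.verts.powerset, (if E(H.induce (T : Set γ)) = ∅ then
      (-1 : R) ^ (V(H) \ T).ncard * ((H.induce (V(H) \ T)).numAcyclicOrientations : R) else 0) =
      ∑ o : {o : H.Orientation // o.IsAcyclic},
        if o.1.AvoidsHeads T then (-1 : R) ^ H.verts.card * (-1) ^ T.card else 0 := by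
    intro T hT
    have hc : (V(H) \ T).ncard + T.card = H.verts.card := by
      rw [← coe_verts, ← Finset.coe_sdiff, Set.ncard_coe_finset]
      exact Finset.card_sdiff_add_card_eq_card (Finset.mem_powerset.1 hT)
    have hs : (-1 : R) ^ H.verts.card * (-1) ^ T.card = (-1) ^ (V(H) \ T).ncard := by
      rw [← hc, pow_add, mul_assoc, ← pow_add, Even.neg_one_pow ⟨_, rfl⟩, mul_one]
    rw [hs, ← Finset.sum_filter, Finset.sum_const, nsmul_eq_mul, mul_comm, ← Fintype.card_subtype,
      ← Nat.card_eq_fintype_card]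
    split_ifs with h
    · rw [card_avoidsHeads h, mul_comm]
    · rw [card_avoidsHeads_eq_zero h, Nat.cast_zero, zero_mul]
  rw [Finset.sum_filter, Finset.sum_congr rfl h1, Finset.sum_comm]
  refine Finset.sum_eq_zero fun o _ => ?_
  obtain ⟨x, hx, hs⟩ := o.2.exists_source hne
  -- For a fixed orientation the admissible `T` are exactly the subsets of the set of sources, which
  -- contains `x`.
  have h2 : (H.verts.powerset.filter fun T : Finset γ => o.1.AvoidsHeads (T : Set γ)) =
      (H.verts.filter fun x => ∀ e : E(H), (o.1.1 e).2 ≠ x).powerset := by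
    ext T
    simp only [Finset.mem_filter, Finset.mem_powerset, Finset.subset_iff, Orientation.AvoidsHeads,
      Finset.mem_coe]
    exact ⟨fun h x hx => ⟨h.1 hx, fun e he => h.2 e (he ▸ hx)⟩,
      fun h => ⟨fun x hx => (h hx).1, fun e he => (h he).2 e rfl⟩⟩
  rw [← Finset.sum_filter, h2, ← Finset.mul_sum]
  have h3 := Finset.sum_powerset_neg_one_pow_card_of_nonempty
    (x := H.verts.filter fun x => ∀ e : E(H), (o.1.1 e).2 ≠ x)
    ⟨x, Finset.mem_filter.2 ⟨by simpa using hx, hs⟩⟩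
  have h4 := congrArg (Int.cast : ℤ → R) h3
  push_cast at h4
  rw [h4, mul_zero]

end Orientations

end Graph

namespace Graph

/-! ### Reachability, contraction and the rank formula -/

section Rank

variable {α β : Type*} {G : Graph α β} {A B : Set β} {e : β} {x y z w : α}

theorem Reachable.refl (G : Graph α β) (x : α) : G.Reachable x x := Relation.ReflTransGen.refl

theorem Reachable.symm (h : G.Reachable x y) : G.Reachable y x := by
  induction h with
  | refl => exact Reachable.refl G x
  | tail _ h ih => exact Relation.ReflTransGen.head h.symm ih

theorem Reachable.trans (h : G.Reachable x y) (h' : G.Reachable y z) : G.Reachable x z :=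
  Relation.ReflTransGen.trans h h'

theorem IsLink.reachable (h : G.IsLink e x y) : G.Reachable x y := .single h.adj

theorem IsLink.restrict_reachable (h : G.IsLink e x y) (he : e ∈ A) :
    (G.restrict A).Reachable x y :=
  IsLink.reachable (e := e) (by simp [h, he])

/-- Reachability is the least reflexive transitive relation containing the links. Besides comparing
reachability relations, this serves to show that a vertex set is closed under paths. -/
theorem Reachable.of_forall_adj {r : α → α → Prop} (hr : ∀ x, r x x)
    (ht : ∀ x y z, r x y → r y z → r x z) (h : ∀ e x y, G.IsLink e x y → r x y)
    (hxy : G.Reachable x y) : r x y := by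
  induction hxy with
  | refl => exact hr x
  | tail _ h' ih => exact ht _ _ _ ih (h _ _ _ h'.choose_spec)

/-- The set of vertices reachable from `x` along edges of `A`. -/
def component (G : Graph α β) (A : Set β) (x : α) : Set α := {y | (G.restrict A).Reachable x y}

theorem mem_component : y ∈ G.component A x ↔ (G.restrict A).Reachable x y := Iff.rfl

theorem component_eq_iff : G.component A x = G.component A y ↔ (G.restrict A).Reachable x y := by
  constructor
  · intro h
    exact mem_component.1 (h ▸ Reachable.refl _ y)
  · exact fun h => Set.ext fun z => ⟨h.symm.trans, h.trans⟩

theorem vertexSet_contract (G : Graph α β) (A : Set β) :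
    V(G.contract A) = G.component A '' V(G) := rfl

theorem edgeSet_contract (G : Graph α β) (A : Set β) : E(G.contract A) = E(G) \ A := by
  simp [contract]

theorem contract_isLink {X Y : Set α} : (G.contract A).IsLink e X Y ↔
    e ∉ A ∧ ∃ x y, G.IsLink e x y ∧ G.component A x = X ∧ G.component A y = Y := by
  simp only [contract, map_isLink, Relation.Map, deleteEdges_isLink]
  exact ⟨fun ⟨x, y, h, h1, h2⟩ => ⟨h.2, x, y, h.1, h1, h2⟩,
    fun ⟨h, x, y, h', h1, h2⟩ => ⟨x, y, ⟨h', h⟩, h1, h2⟩⟩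

instance finite_vertexSet_contract (G : Graph α β) (A : Set β) [Finite V(G)] :
    Finite V(G.contract A) :=
  inferInstanceAs (Finite ↑(G.component A '' V(G)))

instance finite_edgeSet_contract (G : Graph α β) (A : Set β) [Finite E(G)] :
    Finite E(G.contract A) := by
  rw [edgeSet_contract]
  infer_instance

/-- A walk using the new edge can be shortened so that it crosses it only once, in one direction or
the other. -/
theorem reachable_restrict_insert_iff (hl : G.IsLink e x y) :
    (G.restrict (insert e B)).Reachable z w ↔ (G.restrict B).Reachable z w ∨
      ((G.restrict B).Reachable z x ∧ (G.restrict B).Reachable y w) ∨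
      ((G.restrict B).Reachable z y ∧ (G.restrict B).Reachable x w) := by
  have hs : ∀ {a b}, (G.restrict B).Reachable a b → (G.restrict B).Reachable b a := .symm
  have ht : ∀ {a b c}, (G.restrict B).Reachable a b → (G.restrict B).Reachable b c →
    (G.restrict B).Reachable a c := .trans
  have hr := Reachable.refl (G.restrict B)
  have hm : ∀ {a b}, (G.restrict B).Reachable a b → (G.restrict (insert e B)).Reachable a b :=
    Relation.ReflTransGen.mono
      (fun _ _ h => h.mono (restrict_mono_right G (Set.subset_insert e B))) _ _
  constructor
  · intro h
    induction h with
    | refl => exact .inl (hr z)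
    | @tail u v _ h ih =>
      obtain ⟨d, hd⟩ := h
      have hd' : G.IsLink d u v ∧ (d = e ∨ d ∈ B) := by simpa [and_comm] using hd
      obtain ⟨hd', rfl | hdB⟩ := hd'
      · rcases hl.eq_and_eq_or_eq_and_eq hd' with ⟨rfl, rfl⟩ | ⟨rfl, rfl⟩ <;> grind
      · have := hd'.restrict_reachable hdB
        grind
  · have hxy := hl.restrict_reachable (Set.mem_insert e B)
    rintro (h | ⟨h1, h2⟩ | ⟨h1, h2⟩)
    · exact hm h
    · exact ((hm h1).trans hxy).trans (hm h2)
    · exact ((hm h1).trans hxy.symm).trans (hm h2)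

/-- The new edge merges the components of `x` and `y` and leaves the others alone. Once the
component of `y` is discarded, the old components are in bijection with the new ones. -/
theorem ncard_vertexSet_contract_insert [Finite V(G)] (hl : G.IsLink e x y)
    (hxy : ¬ (G.restrict B).Reachable x y) :
    V(G.contract (insert e B)).ncard + 1 = V(G.contract B).ncard := by
  have hs : ∀ {a b}, (G.restrict B).Reachable a b → (G.restrict B).Reachable b a := .symm
  have ht : ∀ {a b c}, (G.restrict B).Reachable a b → (G.restrict B).Reachable b c →
    (G.restrict B).Reachable a c := .trans
  have hr := Reachable.refl (G.restrict B)
  rw [vertexSet_contract, vertexSet_contract]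
  have hy : G.component B y ∈ G.component B '' V(G) := ⟨y, hl.right_mem, rfl⟩
  have hfin : Finite V(G) := inferInstance
  rw [← Set.ncard_sdiff_singleton_add_one hy (Set.Finite.image _ hfin), add_left_inj]
  symm
  -- The union over all members of an old component gives the map to new components without choosing
  -- representatives.
  have hU : ∀ z, (⋃ a ∈ G.component B z, G.component (insert e B) a) =
      G.component (insert e B) z := by
    intro z
    ext a
    simp only [Set.mem_iUnion, mem_component, reachable_restrict_insert_iff hl, exists_prop]
    constructor
    · rintro ⟨b, h1, h2⟩
      grind
    · exact fun h => ⟨z, hr z, h⟩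
  refine Set.ncard_congr (fun X _ => ⋃ a ∈ X, G.component (insert e B) a) ?_ ?_ ?_
  · rintro _ ⟨⟨z, hz, rfl⟩, -⟩
    exact ⟨z, hz, (hU z).symm⟩
  · rintro _ _ ⟨⟨z, hz, rfl⟩, h1⟩ ⟨⟨w, hw, rfl⟩, h2⟩ h
    simp only [Set.mem_singleton_iff, component_eq_iff] at h1 h2
    simp only [hU, component_eq_iff, reachable_restrict_insert_iff hl] at h ⊢
    grind
  · rintro _ ⟨z, hz, rfl⟩
    -- The component of `y` is no longer available, so that of `x` serves as preimage of the merged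
    -- component.
    by_cases hzy : (G.restrict B).Reachable z y
    · refine ⟨G.component B x, ⟨⟨x, hl.left_mem, rfl⟩, ?_⟩, ?_⟩
      · simpa [component_eq_iff] using hxy
      · rw [hU, component_eq_iff, reachable_restrict_insert_iff hl]
        exact .inr (.inl ⟨hr x, hs hzy⟩)
    · refine ⟨G.component B z, ⟨⟨z, hz, rfl⟩, ?_⟩, hU z⟩
      simpa [component_eq_iff] using hzy

theorem ncard_vertexSet_contract_empty (G : Graph α β) :
    V(G.contract ∅).ncard = V(G).ncard := by
  refine Set.ncard_image_of_injective _ fun x y h => ?_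
  have h := component_eq_iff.1 h
  refine Reachable.of_forall_adj (r := Eq) (fun _ => rfl) (fun _ _ _ => Eq.trans) ?_ h
  intro e x y hl
  simp at hl

theorem IsAcyclic.mono {H : Graph α β} (h : H.IsAcyclic) (hGH : G ≤ H) : G.IsAcyclic := by
  rintro ⟨k, v, e, hv, he, hl⟩
  exact h ⟨k, v, e, hv, he, fun i => (hl i).mono hGH⟩

theorem isAcyclic_restrict_empty (G : Graph α β) : (G.restrict ∅).IsAcyclic := by
  rintro ⟨k, v, e, hv, he, hl⟩
  simpa using hl 0

/-- A path in `B` between the ends of `e` would be closed up by `e` to a cycle. -/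
theorem not_reachable_of_isAcyclic_insert (h : (G.restrict (insert e B)).IsAcyclic)
    (hl : G.IsLink e x y) (he : e ∉ B) : ¬ (G.restrict B).Reachable x y := by
  classical
  intro hxy
  -- Passing to the underlying simple graph supplies a path with distinct vertices; an edge of `B`
  -- is then chosen for each of its steps.
  let S : SimpleGraph α := SimpleGraph.fromRel (G.restrict B).Adj
  have hS : S.Reachable x y := by
    refine Reachable.of_forall_adj .refl (fun _ _ _ => .trans) (fun d u v huv => ?_) hxy
    by_cases huv' : u = v
    · exact huv' ▸ .refl _
    · exact SimpleGraph.Adj.reachable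
        ((SimpleGraph.fromRel_adj _ _ _).2 ⟨huv', .inl huv.adj⟩)
  obtain ⟨p, hp⟩ := hS.exists_isPath
  have hd : ∀ i < p.length, ∃ d ∈ B, G.IsLink d (p.getVert i) (p.getVert (i + 1)) := by
    intro i hi
    have hadj := (SimpleGraph.fromRel_adj _ _ _).1 (p.adj_getVert_succ hi)
    obtain ⟨d, hd⟩ | ⟨d, hd⟩ := hadj.2
    · simp only [restrict_isLink] at hd
      exact ⟨d, by tauto⟩
    · have := hd.symm
      simp only [restrict_isLink] at this
      exact ⟨d, by tauto⟩
  choose d hdB hdl using hd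
  have hinj : ∀ i j, i ≤ p.length → j ≤ p.length → p.getVert i = p.getVert j → i = j :=
    fun i j hi hj hij => hp.getVert_injOn hi hj hij
  -- The last index carries `e`, leading from `y` back to `x`. If `e` is a loop, then `p` has length
  -- `0` and the cycle is `e` alone.
  refine h ⟨p.length, fun i => p.getVert i, fun i => if hi : i.1 < p.length then d i hi else e,
    ?_, ?_, ?_⟩
  · exact fun i j hij => Fin.ext (hinj i j (by omega) (by omega) hij)
  · intro i j hij
    dsimp only at hij
    split_ifs at hij with hi hj hj
    · have h1 := hdl i hi
      rw [hij] at h1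
      -- Two steps along the same edge have the same pair of ends; traversal in opposite directions
      -- would give `i = j + 1` and `i + 1 = j`.
      obtain ⟨h2, -⟩ | ⟨h2, h3⟩ := h1.eq_and_eq_or_eq_and_eq (hdl j hj)
      · exact Fin.ext (hinj i j (by omega) (by omega) h2)
      · have h2 := hinj i (j + 1) (by omega) (by omega) h2
        have h3 := hinj (i + 1) j (by omega) (by omega) h3
        omega
    · exact absurd (hij ▸ hdB i hi) he
    · exact absurd (hij ▸ hdB j hj) he
    · exact Fin.ext (by omega)
  · intro i
    dsimp only
    split_ifs with hi
    · have h1 : ((i + 1 : Fin (p.length + 1)) : ℕ) = i + 1 :=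
        Fin.val_add_one_of_lt (Fin.lt_def.2 (by simpa using hi))
      rw [h1]
      simp [hdl i hi, hdB i hi]
    · have h1 : i = Fin.last _ := Fin.ext (by simp; omega)
      subst h1
      simp [hl.symm]

/-- A new cycle must use `e`, and the remainder of the cycle joins the ends of `e` inside `B`. -/
theorem IsAcyclic.restrict_insert (h : (G.restrict B).IsAcyclic)
    (hl : G.IsLink e x y) (hxy : ¬ (G.restrict B).Reachable x y) :
    (G.restrict (insert e B)).IsAcyclic := by
  rintro ⟨k, v, d, hv, hd, hc⟩
  have hc1 : ∀ i, G.IsLink (d i) (v i) (v (i + 1)) := fun i => (hc i).mono restrict_le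
  have hc2 : ∀ i, d i = e ∨ d i ∈ B := fun i => by
    have := (hc i).edge_mem
    simp only [edgeSet_restrict, Set.mem_inter_iff, Set.mem_insert_iff] at this
    exact this.2
  by_cases hB : ∀ i, d i ∈ B
  · exact h ⟨k, v, d, hv, hd, fun i => by simp [hc1 i, hB i]⟩
  push Not at hB
  obtain ⟨i, hi⟩ := hB
  have hie : d i = e := (hc2 i).resolve_right hi
  -- Indices are cyclic modulo `k + 1`. Starting just after `e`, the first `k` steps avoid the index
  -- `i` and hence use edges of `B`; after them the index is back at `i`.
  have hr : ∀ m : ℕ, m ≤ k → (G.restrict B).Reachable (v (i + 1)) (v (i + 1 + Fin.ofNat _ m)) := by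
    intro m hm
    induction m with
    | zero => simpa using Reachable.refl _ _
    | succ m ih =>
      have h1 : i + 1 + Fin.ofNat (k + 1) m + 1 = i + 1 + Fin.ofNat (k + 1) (m + 1) := by
        rw [add_assoc (i + 1)]
        congr 1
        ext
        simp [Fin.val_add]
      have h2 : i + 1 + Fin.ofNat (k + 1) m ≠ i := by
        intro h2
        have h3 : (1 : Fin (k + 1)) + Fin.ofNat (k + 1) m = 0 := by
          rw [add_assoc] at h2
          exact add_eq_left.1 h2
        have h4 := congrArg Fin.val h3
        simp only [Fin.val_add, Fin.val_one', Fin.ofNat_eq_cast, Fin.val_natCast, Fin.val_zero] at h4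
        rw [← Nat.add_mod, Nat.mod_eq_of_lt (by omega)] at h4
        omega
      have h5 : d (i + 1 + Fin.ofNat (k + 1) m) ∈ B :=
        (hc2 _).resolve_left fun h6 => h2 (hd (h6.trans hie.symm))
      have h7 := (hc1 (i + 1 + Fin.ofNat (k + 1) m)).restrict_reachable h5
      rw [h1] at h7
      exact (ih (by omega)).trans h7
  have hk : i + 1 + Fin.ofNat (k + 1) k = i := by
    rw [add_assoc, add_eq_left]
    ext
    simp [add_comm]
  have h8 := hr k le_rfl
  rw [hk] at h8
  have h9 := hc1 i
  rw [hie] at h9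
  rcases hl.eq_and_eq_or_eq_and_eq h9 with ⟨rfl, rfl⟩ | ⟨rfl, rfl⟩
  · exact hxy h8.symm
  · exact hxy h8

/-- Building up `B` edge by edge, every new edge joins two different components and lowers their
number by one. -/
theorem IsAcyclic.ncard_add_ncard [Finite V(G)] (hB : B.Finite) (hBE : B ⊆ E(G))
    (h : (G.restrict B).IsAcyclic) : B.ncard + V(G.contract B).ncard = V(G).ncard := by
  induction B, hB using Set.Finite.induction_on with
  | empty => simp [ncard_vertexSet_contract_empty]
  | @insert e B he hB ih =>
    obtain ⟨x, y, hl⟩ := exists_isLink_of_mem_edgeSet (hBE (Set.mem_insert e B))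
    have h1 := ncard_vertexSet_contract_insert hl (not_reachable_of_isAcyclic_insert h hl he)
    have h2 := ih ((Set.subset_insert e B).trans hBE)
      (h.mono (restrict_mono_right G (Set.subset_insert e B)))
    rw [Set.ncard_insert_of_notMem he hB]
    omega

/-- The rank of a set of edges and the number of components it spans add up to the number of
vertices. -/
theorem rk_add_ncard_vertexSet_contract [Finite V(G)] [Finite E(G)] (A : Set β) :
    G.rk A + V(G.contract A).ncard = V(G).ncard := by
  have hne : {n | ∃ B ⊆ A, B ⊆ E(G) ∧ (G.restrict B).IsAcyclic ∧ B.ncard = n}.Nonempty :=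
    ⟨0, ∅, Set.empty_subset _, Set.empty_subset _, isAcyclic_restrict_empty G, Set.ncard_empty _⟩
  have hbdd : BddAbove {n | ∃ B ⊆ A, B ⊆ E(G) ∧ (G.restrict B).IsAcyclic ∧ B.ncard = n} := by
    refine ⟨E(G).ncard, ?_⟩
    rintro _ ⟨B, -, hB, -, rfl⟩
    exact Set.ncard_le_ncard hB (Set.toFinite _)
  obtain ⟨B, hBA, hBE, hB, hcard⟩ := Nat.sSup_mem hne hbdd
  have hBf : B.Finite := (Set.toFinite E(G)).subset hBE
  -- By maximality of `B`, an edge of `A` cannot join different components of `B`; hence `A` and `B`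
  -- have the same components.
  have key : ∀ e x y, (G.restrict A).IsLink e x y → (G.restrict B).Reachable x y := by
    intro e x y hl
    have hl' : G.IsLink e x y := hl.mono restrict_le
    have heA : e ∈ A := by simpa using hl.edge_mem.2
    by_contra hxy
    have he : e ∉ B := fun he => hxy (hl'.restrict_reachable he)
    have h1 := le_csSup hbdd ⟨insert e B, Set.insert_subset heA hBA,
      Set.insert_subset hl'.edge_mem hBE, hB.restrict_insert hl' hxy, rfl⟩
    rw [Set.ncard_insert_of_notMem he hBf] at h1
    omega
  have hcomp : G.component A = G.component B := by
    funext x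
    ext y
    refine ⟨fun h => Reachable.of_forall_adj (Reachable.refl _) (fun _ _ _ => .trans) key h,
      fun h => Relation.ReflTransGen.mono
        (fun _ _ h => h.mono (restrict_mono_right G hBA)) _ _ h⟩
  have h2 := hB.ncard_add_ncard hBf hBE
  rw [vertexSet_contract] at h2 ⊢
  rw [hcomp, rk, ← hcard]
  exact h2

end Rank

end Graph

namespace Graph

/-! ### Splitting flats and contractions along unions of components -/

section Splitting

variable {α β : Type*} {G : Graph α β} {A F : Set β} {T X : Set α} {e : β} {x y : α}

/-- `X` is a union of connected components of the spanning subgraph with edge set `A`. -/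
def IsComponentUnion (G : Graph α β) (A : Set β) (X : Set α) : Prop :=
  ∀ x ∈ X, ∀ y, (G.restrict A).Reachable x y → y ∈ X

theorem Reachable.right_mem (h : G.Reachable x y) (hx : x ∈ V(G)) : y ∈ V(G) := by
  induction h with
  | refl => exact hx
  | tail _ h _ => exact h.right_mem

theorem IsComponentUnion.of_isLink (h : ∀ e x y, G.IsLink e x y → e ∈ A → x ∈ X → y ∈ X) :
    G.IsComponentUnion A X := fun x hx y hxy =>
  Reachable.of_forall_adj (r := fun a b => a ∈ X → b ∈ X) (fun _ => id)
    (fun _ _ _ h h' => h' ∘ h)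
    (fun e a b hl => h e a b (hl.mono restrict_le) (by simpa using hl.edge_mem.2)) hxy hx

theorem IsComponentUnion.compl (h : G.IsComponentUnion A X) :
    G.IsComponentUnion A (V(G) \ X) := fun x hx y hxy =>
  ⟨hxy.right_mem hx.1, fun hy => hx.2 (h y hy x hxy.symm)⟩

theorem induce_restrict_inter_le (hX : X ⊆ V(G)) :
    (G.induce X).restrict (A ∩ E(G.induce X)) ≤ G.restrict A :=
  (restrict_mono_left (induce_le hX) _).trans (restrict_mono_right G Set.inter_subset_left)

/-- A path in `A` that starts in a union of `A`-components never leaves it, so all its edges survive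
in the induced subgraph. -/
theorem IsComponentUnion.reachable_induce_iff (h : G.IsComponentUnion A X) (hX : X ⊆ V(G))
    (hx : x ∈ X) : ((G.induce X).restrict (A ∩ E(G.induce X))).Reachable x y ↔
      (G.restrict A).Reachable x y := by
  constructor
  · exact Relation.ReflTransGen.mono
      (fun _ _ h => h.mono (induce_restrict_inter_le hX)) _ _
  · intro hxy
    induction hxy with
    | refl => exact .refl _ _
    | @tail u v huv hadj ih =>
      obtain ⟨e, hl⟩ := hadj
      have hl' : G.IsLink e u v := hl.mono restrict_le
      have hu := h x hx u huv
      have hv := h u hu v (IsLink.reachable hl)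
      have hind : (G.induce X).IsLink e u v := ⟨hl', hu, hv⟩
      exact ih.trans (hind.restrict_reachable ⟨by simpa using hl.edge_mem.2, hind.edge_mem⟩)

theorem IsComponentUnion.component_induce (h : G.IsComponentUnion A X) (hX : X ⊆ V(G))
    (hx : x ∈ X) : (G.induce X).component (A ∩ E(G.induce X)) x = G.component A x :=
  Set.ext fun _ => h.reachable_induce_iff hX hx

theorem IsComponentUnion.component_mem_image (h : G.IsComponentUnion A X) :
    G.component A x ∈ G.component A '' X ↔ x ∈ X := by
  constructor
  · rintro ⟨u, hu, hux⟩
    exact h u hu x (component_eq_iff.1 hux)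
  · exact fun hx => ⟨x, hx, rfl⟩

/-- Contraction commutes with passing to a union of components. -/
theorem IsComponentUnion.contract_induce (h : G.IsComponentUnion A X) (hX : X ⊆ V(G)) :
    (G.induce X).contract (A ∩ E(G.induce X)) =
      (G.contract A).induce (G.component A '' X) := by
  -- The graphs are equal, not merely isomorphic: contracted vertices are represented by components,
  -- and these are the same sets of vertices on both sides.
  refine Graph.ext (Set.image_congr fun x hx => h.component_induce hX hx) fun e Y Z => ?_
  rw [contract_isLink]
  constructor
  · rintro ⟨he, x, y, hl, rfl, rfl⟩
    rw [h.component_induce hX hl.2.1, h.component_induce hX hl.2.2]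
    exact ⟨contract_isLink.2 ⟨fun he' => he ⟨he', hl.edge_mem⟩, x, y, hl.1, rfl, rfl⟩,
      ⟨x, hl.2.1, rfl⟩, ⟨y, hl.2.2, rfl⟩⟩
  · rintro ⟨hl, hY, hZ⟩
    obtain ⟨he, x, y, hxy, rfl, rfl⟩ := contract_isLink.1 hl
    rw [h.component_mem_image] at hY hZ
    exact ⟨fun he' => he he'.1, x, y, ⟨hxy, hY, hZ⟩, h.component_induce hX hY,
      h.component_induce hX hZ⟩

theorem IsComponentUnion.image_component_sdiff (h : G.IsComponentUnion A T) :
    G.component A '' (V(G) \ T) = V(G.contract A) \ G.component A '' T := by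
  ext Y
  constructor
  · rintro ⟨x, hx, rfl⟩
    exact ⟨⟨x, hx.1, rfl⟩, h.component_mem_image.not.2 hx.2⟩
  · rintro ⟨⟨x, hx, rfl⟩, hxT⟩
    exact ⟨x, ⟨hx, h.component_mem_image.not.1 hxT⟩, rfl⟩

theorem disjoint_edgeSet_induce_sdiff (G : Graph α β) (T X : Set α) :
    Disjoint E(G.induce T) E(G.induce (X \ T)) := by
  refine Set.disjoint_left.2 fun e he he' => ?_
  obtain ⟨x, y, hl⟩ := exists_isLink_of_mem_edgeSet he
  exact ((mem_edgeSet_induce_of_isLink hl.1).1 he').1.2 hl.2.1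

/-- No edge of the union crosses between `T` and its complement. -/
theorem isComponentUnion_edgeSet_induce_union (hF : F ⊆ E(G.induce (V(G) \ T))) :
    G.IsComponentUnion (E(G.induce T) ∪ F) T := by
  refine .of_isLink fun e x y hl he hx => ?_
  rcases he with he | he
  · exact ((mem_edgeSet_induce_of_isLink hl).1 he).2
  · exact absurd hx ((mem_edgeSet_induce_of_isLink hl).1 (hF he)).1.2

theorem edgeSet_induce_union_inter (hF : F ⊆ E(G.induce (V(G) \ T))) :
    (E(G.induce T) ∪ F) ∩ E(G.induce (V(G) \ T)) = F := by
  rw [Set.union_inter_distrib_right, (disjoint_edgeSet_induce_sdiff G T _).inter_eq,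
    Set.empty_union, Set.inter_eq_left.2 hF]

/-- A path stays on one side of `T`. Inside `T` all edges are present, and outside `T` the flatness
of `F` applies. -/
theorem IsFlat.edgeSet_induce_union (hF : (G.induce (V(G) \ T)).IsFlat F) :
    G.IsFlat (E(G.induce T) ∪ F) := by
  refine ⟨Set.union_subset (edgeSet_induce_subset _ _)
    (hF.1.trans (edgeSet_induce_subset _ _)), fun e x y hl hxy => ?_⟩
  have hT := isComponentUnion_edgeSet_induce_union hF.1
  by_cases hx : x ∈ T
  · exact .inl ((mem_edgeSet_induce_of_isLink hl).2 ⟨hx, hT x hx y hxy⟩)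
  · have hx' : x ∈ V(G) \ T := ⟨hl.left_mem, hx⟩
    have h := (hT.compl.reachable_induce_iff Set.sdiff_subset hx').2 hxy
    rw [edgeSet_induce_union_inter hF.1] at h
    exact .inr (hF.2 e x y ⟨hl, hx', hT.compl x hx' y hxy⟩ h)

theorem IsFlat.inter_edgeSet_induce (hA : G.IsFlat A) (hX : X ⊆ V(G)) :
    (G.induce X).IsFlat (A ∩ E(G.induce X)) :=
  ⟨Set.inter_subset_right, fun e x y hl hxy => ⟨hA.2 e x y hl.1
    (Relation.ReflTransGen.mono (fun _ _ h => h.mono (induce_restrict_inter_le hX)) _ _ hxy),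
    hl.edge_mem⟩⟩

/-- Each edge of `A` has both ends on the same side of `T`. Together with
`edgeSet_induce_union_inter` this makes `(T, F) ↦ (A, T)` invertible. -/
theorem IsComponentUnion.edgeSet_induce_union_inter_eq (h : G.IsComponentUnion A T)
    (hA : A ⊆ E(G)) (hT : E(G.induce T) ⊆ A) :
    E(G.induce T) ∪ A ∩ E(G.induce (V(G) \ T)) = A := by
  refine Set.Subset.antisymm (Set.union_subset hT Set.inter_subset_left) fun e he => ?_
  obtain ⟨x, y, hl⟩ := exists_isLink_of_mem_edgeSet (hA he)
  have hxy := hl.restrict_reachable he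
  by_cases hx : x ∈ T
  · exact .inl ((mem_edgeSet_induce_of_isLink hl).2 ⟨hx, h x hx y hxy⟩)
  · have hx' : x ∈ V(G) \ T := ⟨hl.left_mem, hx⟩
    exact .inr ⟨he, (mem_edgeSet_induce_of_isLink hl).2 ⟨hx', h.compl x hx' y hxy⟩⟩

/-- The two summands have disjoint vertex sets and disjoint edge sets inside `G`, so forgetting the
side is injective on vertices and on edges. -/
theorem isIso_disjSum_induce_restrict (hT : T ⊆ V(G)) (hF : F ⊆ E(G.induce (V(G) \ T))) :
    ((G.induce T).disjSum ((G.induce (V(G) \ T)).restrict F)).IsIso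
      (G.restrict (E(G.induce T) ∪ F)) := by
  refine IsIso.of_bijOn (Sum.elim id id) (Sum.elim id id) ⟨?_, ?_, ?_⟩ ⟨?_, ?_, ?_⟩ ?_
  · rintro _ (⟨x, hx, rfl⟩ | ⟨x, hx, rfl⟩)
    · exact hT hx
    · exact hx.1
  · rintro _ (⟨x, hx, rfl⟩ | ⟨x, hx, rfl⟩) _ (⟨y, hy, rfl⟩ | ⟨y, hy, rfl⟩) (rfl : x = y)
    · rfl
    · exact absurd hx hy.2
    · exact absurd hy hx.2
    · rfl
  · intro x hx
    by_cases hxT : x ∈ T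
    · exact ⟨.inl x, .inl ⟨x, hxT, rfl⟩, rfl⟩
    · exact ⟨.inr x, .inr ⟨x, ⟨hx, hxT⟩, rfl⟩, rfl⟩
  · rintro _ (⟨e, he, rfl⟩ | ⟨e, he, rfl⟩)
    · exact ⟨edgeSet_induce_subset _ _ he, .inl he⟩
    · exact ⟨edgeSet_induce_subset _ _ he.1, .inr he.2⟩
  · have hd := Set.disjoint_left.1 (disjoint_edgeSet_induce_sdiff G T V(G))
    rintro _ (⟨x, hx, rfl⟩ | ⟨x, hx, rfl⟩) _ (⟨y, hy, rfl⟩ | ⟨y, hy, rfl⟩) (rfl : x = y)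
    · rfl
    · exact absurd hy.1 (hd hx)
    · exact absurd hx.1 (hd hy)
    · rfl
  · rintro e ⟨-, he | he⟩
    · exact ⟨.inl e, .inl ⟨e, he, rfl⟩, rfl⟩
    · exact ⟨.inr e, .inr ⟨e, ⟨hF he, he⟩, rfl⟩, rfl⟩
  · rintro _ _ _ (⟨e, x, y, rfl, rfl, rfl, hl⟩ | ⟨e, x, y, rfl, rfl, rfl, hl⟩)
    · exact ⟨.inl hl.edge_mem, hl.1⟩
    · exact ⟨.inr hl.1, hl.2.1⟩

end Splitting

end Graph

/-! ### The recursion for the antipode and for the flat expansion -/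

namespace GraphAlgebra

open Graph

variable {k : Type*} [Field k] {α β : Type*}

/-- The coefficient of the spanning subgraph with edge set `A` in the antipode of `G`. -/
noncomputable def antipodeCoeff (k : Type*) [Field k] (G : Graph α β) (A : Set β) : k :=
  (-1 : k) ^ ((V(G).ncard : ℤ) - (G.rk A : ℤ)) * ((G.contract A).numAcyclicOrientations : k)

/-- By the rank formula the exponent counts the vertices of the contraction, so the coefficient
depends on the contraction only. -/
theorem antipodeCoeff_eq (G : Graph α β) [Finite V(G)] [Finite E(G)] (A : Set β) :
    antipodeCoeff k G A =
      (-1) ^ V(G.contract A).ncard * ((G.contract A).numAcyclicOrientations : k) := by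
  rw [antipodeCoeff, ← G.rk_add_ncard_vertexSet_contract A, Nat.cast_add, add_sub_cancel_left,
    zpow_natCast]

/-- The expansion of the antipode of `G` over the flats of `G`. -/
noncomputable def flatSum (k : Type*) [Field k] (G : Graph α β) [Finite V(G)] [Finite E(G)] :
    GraphAlgebra k :=
  ∑ A ∈ G.flats, antipodeCoeff k G A • of k (G.restrict A)

open scoped Classical in
-- This is the total coefficient of the subgraph with edge set `A` in the recursion. Unions of
-- `A`-components are preimages of vertex sets of `G.contract A`, and `E(G.induce T) ⊆ A` says that
-- the vertex set is independent there, so the alternating sum over independent sets applies.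
theorem sum_antipodeCoeff_eq_zero (G : Graph α β) [Finite V(G)] [Finite E(G)]
    (hne : V(G).Nonempty) (A : Set β) :
    ∑ T ∈ G.verts.powerset.filter fun T : Finset α =>
        G.IsComponentUnion A T ∧ E(G.induce (T : Set α)) ⊆ A,
      antipodeCoeff k (G.induce (V(G) \ T)) (A ∩ E(G.induce (V(G) \ T))) = 0 := by
  rw [← sum_neg_one_pow_mul_numAcyclicOrientations (R := k) (G.contract A)
    (hne.image (G.component A))]
  refine Finset.sum_bij' (fun T _ => T.image (G.component A))
    (fun S _ => G.verts.filter fun x => G.component A x ∈ S) ?_ ?_ ?_ ?_ ?_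
  · intro T hT
    simp only [Finset.mem_filter, Finset.mem_powerset] at hT ⊢
    refine ⟨fun Y hY => ?_, Set.eq_empty_of_forall_notMem fun e he => ?_⟩
    · obtain ⟨x, hx, rfl⟩ := Finset.mem_image.1 hY
      rw [mem_verts]
      exact ⟨x, by simpa using hT.1 hx, rfl⟩
    · obtain ⟨Y, Z, hl, hY, hZ⟩ := exists_isLink_of_mem_edgeSet he
      obtain ⟨heA, x, y, hxy, rfl, rfl⟩ := contract_isLink.1 hl
      rw [Finset.coe_image, hT.2.1.component_mem_image] at hY hZ
      exact heA (hT.2.2 ((mem_edgeSet_induce_of_isLink hxy).2 ⟨hY, hZ⟩))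
  · intro S hS
    simp only [Finset.mem_filter, Finset.mem_powerset] at hS ⊢
    refine ⟨Finset.filter_subset _ _, fun x hx y hxy => ?_, fun e he => ?_⟩
    · simp only [Finset.coe_filter, mem_verts, Set.mem_ofPred_eq] at hx ⊢
      exact ⟨hxy.right_mem hx.1, component_eq_iff.2 hxy ▸ hx.2⟩
    · obtain ⟨x, y, hl, hx, hy⟩ := exists_isLink_of_mem_edgeSet he
      simp only [Finset.coe_filter, mem_verts, Set.mem_ofPred_eq] at hx hy
      by_contra heA
      have : (G.contract A).IsLink e (G.component A x) (G.component A y) :=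
        contract_isLink.2 ⟨heA, x, y, hl, rfl, rfl⟩
      exact (Set.eq_empty_iff_forall_notMem.1 hS.2) e
        ((mem_edgeSet_induce_of_isLink this).2 ⟨hx.2, hy.2⟩)
  · intro T hT
    simp only [Finset.mem_filter, Finset.mem_powerset] at hT
    ext x
    rw [Finset.mem_filter, mem_verts, ← Finset.mem_coe, Finset.coe_image,
      hT.2.1.component_mem_image]
    exact ⟨fun h => h.2, fun h => ⟨by simpa using hT.1 h, h⟩⟩
  · intro S hS
    simp only [Finset.mem_filter, Finset.mem_powerset] at hS
    ext Y
    simp only [Finset.mem_image, Finset.mem_filter, mem_verts]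
    constructor
    · rintro ⟨x, hx, rfl⟩
      exact hx.2
    · intro hY
      have := hS.1 hY
      rw [mem_verts] at this
      obtain ⟨x, hx, rfl⟩ := this
      exact ⟨x, ⟨hx, hY⟩, rfl⟩
  · intro T hT
    simp only [Finset.mem_filter, Finset.mem_powerset] at hT
    -- Contracting in the complement of `T` gives `G.contract A` with the image of `T` deleted, so
    -- the terms match.
    rw [antipodeCoeff_eq, hT.2.1.compl.contract_induce Set.sdiff_subset, Finset.coe_image,
      ← hT.2.1.image_component_sdiff]
    rfl

theorem of_induce_mul_of_restrict (G : Graph α β) [Finite V(G)] [Finite E(G)] {T : Set α}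
    [Finite T] (hT : T ⊆ V(G)) {F : Set β} (hF : F ⊆ E(G.induce (V(G) \ T))) :
    of k (G.induce T) * of k ((G.induce (V(G) \ T)).restrict F) =
      of k (G.restrict (E(G.induce T) ∪ F)) := by
  rw [of_mul_of, of, of, GraphClass.mk_eq_mk.2 (isIso_disjSum_induce_restrict hT hF)]

open scoped Classical in
-- Collecting the expanded products by the edge set of the resulting spanning subgraph leaves, for
-- each flat `A`, a vanishing coefficient.
theorem sum_of_induce_mul_flatSum (G : Graph α β) [Finite V(G)] [Finite E(G)]
    (hne : V(G).Nonempty) :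
    ∑ T ∈ G.verts.powerset, of k (G.induce (T : Set α)) *
      flatSum k (G.induce (V(G) \ T)) = 0 := by
  have h1 : ∀ T ∈ G.verts.powerset,
      of k (G.induce (T : Set α)) * flatSum k (G.induce (V(G) \ T)) =
      ∑ F ∈ (G.induce (V(G) \ T)).flats, antipodeCoeff k (G.induce (V(G) \ T)) F •
        of k (G.restrict (E(G.induce T) ∪ F)) := by
    intro T hT
    have hT' : (T : Set α) ⊆ V(G) := fun x hx => by simpa using Finset.mem_powerset.1 hT hx
    rw [flatSum, Finset.mul_sum]
    refine Finset.sum_congr rfl fun F hF => ?_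
    rw [mul_smul_comm, of_induce_mul_of_restrict G hT' ((mem_flats _).1 hF).1]
  have h2 : ∑ A ∈ G.flats, ∑ T ∈ G.verts.powerset.filter fun T : Finset α =>
        G.IsComponentUnion A T ∧ E(G.induce (T : Set α)) ⊆ A,
      antipodeCoeff k (G.induce (V(G) \ T)) (A ∩ E(G.induce (V(G) \ T))) •
        of k (G.restrict A) = 0 :=
    Finset.sum_eq_zero fun A _ => by
      rw [← Finset.sum_smul, sum_antipodeCoeff_eq_zero G hne A, zero_smul]
  rw [Finset.sum_congr rfl h1, ← h2, Finset.sum_sigma', Finset.sum_sigma']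
  -- The pair `(T, F)` goes to `(E(G.induce T) ∪ F, T)`; conversely `F` is the part of `A` lying
  -- outside `T`.
  refine Finset.sum_bij' (fun p _ => ⟨E(G.induce (p.1 : Set α)) ∪ p.2, p.1⟩)
    (fun p _ => ⟨p.2, p.1 ∩ E(G.induce (V(G) \ (p.2 : Set α)))⟩) ?_ ?_ ?_ ?_ ?_
  · rintro ⟨T, F⟩ h
    simp only [Finset.mem_sigma, Finset.mem_filter, mem_flats] at h ⊢
    exact ⟨h.2.edgeSet_induce_union, h.1, isComponentUnion_edgeSet_induce_union h.2.1,
      Set.subset_union_left⟩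
  · rintro ⟨A, T⟩ h
    simp only [Finset.mem_sigma, Finset.mem_filter, mem_flats] at h ⊢
    exact ⟨h.2.1, h.1.inter_edgeSet_induce Set.sdiff_subset⟩
  · rintro ⟨T, F⟩ h
    simp only [Finset.mem_sigma, mem_flats] at h
    simp only [edgeSet_induce_union_inter h.2.1]
  · rintro ⟨A, T⟩ h
    simp only [Finset.mem_sigma, Finset.mem_filter, mem_flats] at h
    simp only [h.2.2.1.edgeSet_induce_union_inter_eq h.1.1 h.2.2.2]
  · rintro ⟨T, F⟩ h
    simp only [Finset.mem_sigma, mem_flats] at h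
    simp only [edgeSet_induce_union_inter h.2.1]

theorem numAcyclicOrientations_of_edgeSet_eq_empty {G : Graph α β} (h : E(G) = ∅) :
    G.numAcyclicOrientations = 1 := by
  have he : IsEmpty E(G) := by simp [h]
  refine Nat.card_eq_one_iff_unique.2 ⟨⟨fun o o' => ?_⟩, ⟨⟨⟨isEmptyElim, isEmptyElim⟩, ?_⟩⟩⟩
  · exact Subtype.ext (Subtype.ext (Subsingleton.elim _ _))
  · intro x hx
    obtain ⟨_, -, e, -⟩ := Relation.TransGen.tail'_iff.1 hx
    exact he.elim e

theorem flatSum_of_vertexSet_eq_empty {G : Graph α β} [Finite V(G)] [Finite E(G)]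
    (h : V(G) = ∅) : flatSum k G = 1 := by
  have hE : E(G) = ∅ := Set.eq_empty_of_forall_notMem fun e he => by
    obtain ⟨x, y, hl⟩ := exists_isLink_of_mem_edgeSet he
    simpa [h] using hl.left_mem
  have hflats : G.flats = {∅} := by
    ext A
    rw [mem_flats, Finset.mem_singleton]
    constructor
    · exact fun hA => Set.subset_empty_iff.1 (hE ▸ hA.1)
    · rintro rfl
      exact ⟨Set.empty_subset _, fun e x y hl => absurd hl.edge_mem (by simp [hE])⟩
  rw [flatSum, hflats, Finset.sum_singleton, antipodeCoeff_eq,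
    numAcyclicOrientations_of_edgeSet_eq_empty (by rw [edgeSet_contract, hE, Set.empty_sdiff]),
    vertexSet_contract, h, Set.image_empty, Set.ncard_empty, pow_zero, Nat.cast_one, mul_one,
    one_smul, of, GraphClass.mk_eq_one (show V(G.restrict ∅) = ∅ from h), map_one]

/-- This is `antipode_right` evaluated at `G`, where the counit vanishes. -/
theorem sum_of_induce_mul_antipode (G : Graph α β) [Finite V(G)] [Finite E(G)]
    (hne : V(G).Nonempty) :
    ∑ T ∈ G.verts.powerset, of k (G.induce (T : Set α)) *
      HopfAlgebra.antipode k (of k (G.induce (V(G) \ T))) = 0 := by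
  classical
  have h := congrArg (fun φ : WithConv (GraphAlgebra k →ₗ[k] GraphAlgebra k) => φ (of k G))
    (antipode_right k)
  have h1 : (1 : WithConv (GraphAlgebra k →ₗ[k] GraphAlgebra k)) (of k G) = 0 := by
    change algebraMap k _ (Coalgebra.counit (R := k) (of k G)) = 0
    rw [counit_of, if_neg fun h0 => hne.ne_empty ((Set.ncard_eq_zero (Set.toFinite _)).1 h0), map_zero]
  refine Eq.trans ?_ ((convMul_of _ _ G).symm.trans (h.trans h1))
  refine Finset.sum_congr rfl fun T _ => ?_
  have h2 : G.induce (V(G) \ (T : Set α)) = G.induce (↑(G.verts \ T) : Set α) := by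
    rw [Finset.coe_sdiff, coe_verts]
  rw [of, of, GraphClass.mk_congr h2]
  rfl

/-- Both sides satisfy the same recursion, whose terms with `T ≠ ∅` agree by induction on the number
of vertices; cancelling them leaves the term `T = ∅`. -/
theorem antipode_of_eq_flatSum (G : Graph α β) [Finite V(G)] [Finite E(G)] :
    HopfAlgebra.antipode k (of k G) = flatSum k G := by
  classical
  induction hn : V(G).ncard using Nat.strong_induction_on generalizing G with
  | _ n ih =>
  rcases V(G).eq_empty_or_nonempty with h | hne
  · rw [flatSum_of_vertexSet_eq_empty h, of, GraphClass.mk_eq_one h, map_one,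
      HopfAlgebra.antipode_one]
  have h1 := sum_of_induce_mul_antipode (k := k) G hne
  rw [← sum_of_induce_mul_flatSum G hne, ← Finset.add_sum_erase _ _ (Finset.empty_mem_powerset _),
    ← Finset.add_sum_erase _ _ (Finset.empty_mem_powerset G.verts)] at h1
  have h2 : ∀ T ∈ G.verts.powerset.erase ∅, of k (G.induce (T : Set α)) *
      HopfAlgebra.antipode k (of k (G.induce (V(G) \ T))) =
      of k (G.induce (T : Set α)) * flatSum k (G.induce (V(G) \ T)) := by
    intro T hT
    rw [Finset.mem_erase, Finset.mem_powerset] at hT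
    rw [ih _ ?_ _ rfl]
    obtain ⟨x, hx⟩ := Finset.nonempty_iff_ne_empty.2 hT.1
    rw [← hn]
    refine Set.ncard_lt_ncard ⟨Set.sdiff_subset, fun h => ?_⟩ (Set.toFinite V(G))
    exact (h (by simpa using hT.2 hx)).2 hx
  rw [Finset.sum_congr rfl h2, add_left_inj, of, GraphClass.mk_eq_one (by simp), map_one, one_mul,
    one_mul] at h1
  have h3 : G.induce (V(G) \ ((∅ : Finset α) : Set α)) = G := by simp
  -- The finiteness instances depend on the graph, so the equality `h3` is used by substituting a
  -- variable graph rather than by rewriting.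
  have h4 : ∀ (H : Graph α β) [Finite V(H)] [Finite E(H)], H = G →
      HopfAlgebra.antipode k (of k H) = flatSum k H →
      HopfAlgebra.antipode k (of k G) = flatSum k G := by
    rintro H _ _ rfl h
    exact h
  exact h4 _ h3 h1

end GraphAlgebra

theorem theorem3p1 {k : Type*} [Field k] [CharZero k] {α β : Type*} (G : Graph α β)
    [Finite V(G)] [Finite E(G)] :
    HopfAlgebra.antipode k (GraphAlgebra.of k G) =
      ∑ A ∈ G.flats, ((-1 : k) ^ ((V(G).ncard : ℤ) - (G.rk A : ℤ)) *
        ((G.contract A).numAcyclicOrientations : k)) • GraphAlgebra.of k (G.restrict A) :=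
  GraphAlgebra.antipode_of_eq_flatSum G
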